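/- Let $a,b:[0,\infty)\to\mathbb R$ be Lebesgue measurable and essentially bounded, and let $g,h:[0,\infty)\to\mathbb R$ be Lebesgue measurable with $g(t)\le t$ and $h(t)\le t$ for $t\ge 0$. Consider the equation $$\ddot x(t)+a(t)\dot x(g(t))+b(t)x(h(t))=0. \qquad (1)$$ For $t_0\ge 0$, bounded Borel functions $\varphi,\psi:(-\infty,t_0)\to\mathbb R$ and $x_0,x_0'\in\mathbb R$, its solution with $x(t)=\varphi(t)$, $\dot x(t)=\psi(t)$ for $t<t_0$ ($\varphi$ and $\psi$ being prescribed independently), $x(t_0)=x_0$, $\dot x(t_0)=x_0'$ is the function $x$ whose derivative on $[t_0,\infty)$ is locally absolutely continuous and which satisfies (1) for almost every $t\ge t_0$. Equation (1) is called exponentially stable if there are $M,\mu>0$, independent of $t_0\ge0$ and of the initial data, such that all these solutions satisfy $$|x(t)|\le M e^{-\mu(t-t_0)}\Big[|x(t_0)|+|\dot x(t_0)|+\sup_{t<t_0}\big(|\varphi(t)|+|\psi(t)|\big)\Big],\qquad t\ge t_0 .$$ Suppose that the ordinary differential equation $$\ddot x(t)+a(t)\dot x(t)+b(t)x(t)=0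 \qquad (11)$$ (that is, (1) with $g(t)=h(t)=t$) is exponentially stable. Let $Y(t,s)$ be its fundamental function: for each $s\ge0$, $Y(\cdot,s)$ solves (11) on $[s,\infty)$ with $x(s)=0$, $\dot x(s)=1$, and $Y(t,s)=0$ for $t<s$. Let $t_0\ge 0$, and suppose that - the fundamental function $Z(t,s)$ of the first-order equation $\dot x(t)+a(t)x(g(t))=0$ (for each $s\ge 0$, $Z(\cdot,s)$ is the locally absolutely continuous solution on $[s,\infty)$ with $Z(s,s)=1$ and $Z(t,s)=0$ for $t<s$) is positive: $Z(t,s)>0$ for $t\ge s\ge t_0$; - for some constants $\alpha>0$, $\delta$, $\tau$, we have $a(t)\ge\alpha$ for almost every $t\ge t_0$, and $t-g(t)\le\delta$, $t-h(t)\le\tau$ for all $t\ge t_0$. Put $Y=\sup_{t>t_0}\int_{t_0}^t|Y(t,s)|\,ds$. If for some $t_1\ge t_0+\delta$ $$Y\left[\delta\|a\|\left(\|a\|\left\|\frac ba\right\|+\|b\|\right)+\tau\|b\|\left\|\frac ba\right\|\right]<1,$$ where $\|\cdot\|$ is the norm of $L_\infty[t_1,\infty)$, then equation (1) is exponentially stable.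 -/

import Mathlib

open MeasureTheory Set
open scoped ENNReal

/-- `x`, together with its derivative `v`, is a solution of the initial value problem
`x''(t) + a(t) x'(g(t)) + b(t) x(h(t)) = 0` for `t ≥ t₀`,
`x(t) = φ(t)`, `x'(t) = ψ(t)` for `t < t₀`, `x(t₀) = x₀`, `x'(t₀) = x₁`.
The prehistories `φ` of `x` and `ψ` of `x'` are prescribed independently of each other, so the
function written `x'` in the equation is the function `v`, equal to `ψ` before `t₀` and to the
(at `t₀` one-sided) derivative of `x` from `t₀` on. -/
structure IsDelaySolution (a b g h : ℝ → ℝ) (t₀ : ℝ) (φ ψ : ℝ → ℝ) (x₀ x₁ : ℝ)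
    (x v : ℝ → ℝ) : Prop where
  prehistory : ∀ t < t₀, x t = φ t
  prehistory_deriv : ∀ t < t₀, v t = ψ t
  initial : x t₀ = x₀
  initial_deriv : v t₀ = x₁
  hasDeriv : ∀ t, t₀ ≤ t → HasDerivWithinAt x (v t) (Ici t₀) t
  absolutelyContinuous : ∀ T, t₀ ≤ T → AbsolutelyContinuousOnInterval v t₀ T
  equation : ∀ᵐ t ∂(volume.restrict (Ici t₀)),
    DifferentiableAt ℝ v t ∧ deriv v t + a t * v (g t) + b t * x (h t) = 0

/-- (Uniform) exponential stability of `x''(t) + a(t) x'(g(t)) + b(t) x(h(t)) = 0`. -/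
def IsExponentiallyStable (a b g h : ℝ → ℝ) : Prop :=
  ∃ M > 0, ∃ μ > 0, ∀ t₀ : ℝ, 0 ≤ t₀ → ∀ φ ψ : ℝ → ℝ, Measurable φ → Measurable ψ →
    BddAbove ((fun t => |φ t|) '' Iio t₀) → BddAbove ((fun t => |ψ t|) '' Iio t₀) →
    ∀ (x₀ x₁ : ℝ) (x v : ℝ → ℝ), IsDelaySolution a b g h t₀ φ ψ x₀ x₁ x v →
      ∀ t, t₀ ≤ t → |x t| ≤
        M * Real.exp (-μ * (t - t₀)) * (|x₀| + |x₁| + ⨆ r : Iio t₀, (|φ r| + |ψ r|))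

/-- `X = X(t, s)` is the fundamental function of
`x''(t) + a(t) x'(g(t)) + b(t) x(h(t)) = 0`: for every `s ≥ 0`, `X(·, s)` is the solution with
zero prehistory, `x(s) = 0` and `x'(s) = 1`. -/
def IsFundamentalFunction (a b g h : ℝ → ℝ) (X : ℝ → ℝ → ℝ) : Prop :=
  ∀ s, 0 ≤ s → ∃ v : ℝ → ℝ,
    IsDelaySolution a b g h s (fun _ => 0) (fun _ => 0) 0 1 (fun t => X t s) v

/-- `Z = Z(t, s)` is the fundamental function of the first order equation
`x'(t) + a(t) x(g(t)) = 0`: for every `s ≥ 0`, `Z(·, s)` is the locally absolutely continuous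
solution on `[s, ∞)` with zero prehistory and `x(s) = 1`. -/
structure IsFirstOrderFundamentalFunction (a g : ℝ → ℝ) (Z : ℝ → ℝ → ℝ) : Prop where
  prehistory : ∀ s, 0 ≤ s → ∀ t < s, Z t s = 0
  initial : ∀ s, 0 ≤ s → Z s s = 1
  absolutelyContinuous : ∀ s, 0 ≤ s → ∀ T, s ≤ T →
    AbsolutelyContinuousOnInterval (fun t => Z t s) s T
  equation : ∀ s, 0 ≤ s → ∀ᵐ t ∂(volume.restrict (Ici s)),
    DifferentiableAt ℝ (fun r => Z r s) t ∧ deriv (fun r => Z r s) t + a t * Z (g t) s = 0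

/-- The norm of `L_∞[t₁, ∞)` (as an extended nonnegative real). -/
noncomputable def linftyNorm (t₁ : ℝ) (f : ℝ → ℝ) : ℝ≥0∞ :=
  eLpNorm f ∞ (volume.restrict (Ici t₁))

/-- `sup_{t > t₀} ∫_{t₀}^t |Y(t, s)| ds` (as an extended nonnegative real). -/
noncomputable def supIntegral (t₀ : ℝ) (Y : ℝ → ℝ → ℝ) : ℝ≥0∞ :=
  ⨆ t ∈ Ioi t₀, ∫⁻ s in Icc t₀ t, ENNReal.ofReal |Y t s|

namespace AbsolutelyContinuousOnInterval

theorem congr_of_eqOn {f g : ℝ → ℝ} {a b : ℝ} (hf : AbsolutelyContinuousOnInterval f a b)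
    (h : EqOn f g (uIcc a b)) : AbsolutelyContinuousOnInterval g a b := by
  rw [absolutelyContinuousOnInterval_iff] at hf ⊢
  intro ε hε
  obtain ⟨d, hd, H⟩ := hf ε hε
  refine ⟨d, hd, fun E hE hEd => ?_⟩
  refine lt_of_eq_of_lt (Finset.sum_congr rfl fun i hi => ?_) (H E hE hEd)
  rw [h (hE.1 i hi).1, h (hE.1 i hi).2]

theorem fun_inv_of_le_abs {f : ℝ → ℝ} {a b c : ℝ} (hf : AbsolutelyContinuousOnInterval f a b)
    (hc : 0 < c) (h : ∀ t ∈ uIcc a b, c ≤ |f t|) :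
    AbsolutelyContinuousOnInterval (fun t => (f t)⁻¹) a b := by
  rw [absolutelyContinuousOnInterval_iff] at hf ⊢
  intro ε hε
  obtain ⟨d, hd, H⟩ := hf (ε * c ^ 2) (by positivity)
  refine ⟨d, hd, fun E hE hEd => ?_⟩
  have h1 := H E hE hEd
  have h2 : ∑ i ∈ Finset.range E.1, dist ((f (E.2 i).1)⁻¹) ((f (E.2 i).2)⁻¹) ≤
      ∑ i ∈ Finset.range E.1, dist (f (E.2 i).1) (f (E.2 i).2) / c ^ 2 := by
    refine Finset.sum_le_sum fun i hi => ?_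
    have k1 := h _ (hE.1 i hi).1
    have k2 := h _ (hE.1 i hi).2
    have n1 : f (E.2 i).1 ≠ 0 := abs_pos.1 (hc.trans_le k1)
    have n2 : f (E.2 i).2 ≠ 0 := abs_pos.1 (hc.trans_le k2)
    rw [Real.dist_eq, Real.dist_eq, inv_sub_inv n1 n2, abs_div, abs_mul, abs_sub_comm]
    gcongr
    nlinarith
  rw [← Finset.sum_div] at h2
  refine h2.trans_lt ?_
  rwa [div_lt_iff₀ (by positivity)]

theorem sub_le_integral_of_deriv_le {u F : ℝ → ℝ} {T S : ℝ} (hTS : T ≤ S)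
    (hu : AbsolutelyContinuousOnInterval u T S) (hF : IntervalIntegrable F volume T S)
    (h : ∀ᵐ t, t ∈ Icc T S → deriv u t ≤ F t) : u S - u T ≤ ∫ t in T..S, F t := by
  rw [← hu.integral_deriv_eq_sub]
  refine intervalIntegral.integral_mono_ae_restrict hTS hu.intervalIntegrable_deriv hF ?_
  exact (ae_restrict_iff' measurableSet_Icc).2 h

theorem abs_sub_le_integral_of_abs_deriv_le {u F : ℝ → ℝ} {T S : ℝ} (hTS : T ≤ S)
    (hu : AbsolutelyContinuousOnInterval u T S) (hF : IntervalIntegrable F volume T S)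
    (h : ∀ᵐ t, t ∈ Icc T S → |deriv u t| ≤ F t) : |u S - u T| ≤ ∫ t in T..S, F t := by
  rw [abs_le']
  refine ⟨hu.sub_le_integral_of_deriv_le hTS hF ?_, ?_⟩
  · filter_upwards [h] with t ht hts using (le_abs_self _).trans (ht hts)
  · have := hu.fun_neg.sub_le_integral_of_deriv_le hTS hF ?_
    · linarith
    · filter_upwards [h] with t ht hts
      rw [deriv.fun_neg]
      exact (neg_le_abs _).trans (ht hts)

end AbsolutelyContinuousOnInterval

theorem absolutelyContinuousOnInterval_of_hasDerivWithinAt {x v : ℝ → ℝ} {T S : ℝ}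
    (hx : ∀ t ∈ uIcc T S, HasDerivWithinAt x (v t) (uIcc T S) t)
    (hv : ContinuousOn v (uIcc T S)) : AbsolutelyContinuousOnInterval x T S := by
  obtain ⟨C, hC⟩ := isCompact_uIcc.exists_bound_of_continuousOn hv
  refine LipschitzOnWith.absolutelyContinuousOnInterval (K := C.toNNReal) ?_
  refine (convex_uIcc T S).lipschitzOnWith_of_nnnorm_hasDerivWithin_le hx fun t ht => ?_
  rw [← NNReal.coe_le_coe, coe_nnnorm]
  exact (hC t ht).trans (Real.le_coe_toNNReal C)

theorem integral_exp_mul_sub {κ : ℝ} (hκ : κ ≠ 0) (c r t : ℝ) :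
    ∫ s in r..t, Real.exp (κ * (s - c)) =
      (Real.exp (κ * (t - c)) - Real.exp (κ * (r - c))) / κ := by
  have h : ∀ s, HasDerivAt (fun s => Real.exp (κ * (s - c)) / κ) (Real.exp (κ * (s - c))) s := by
    intro s
    have h1 : HasDerivAt (fun s => κ * (s - c)) κ s := by
      simpa using ((hasDerivAt_id s).sub_const c).const_mul κ
    convert! (h1.exp.div_const κ) using 1
    field_simp
  rw [intervalIntegral.integral_eq_sub_of_hasDerivAt (fun s _ => h s)
    (by apply Continuous.intervalIntegrable; fun_prop)]
  ring

/-- If, almost everywhere, an absolutely continuous function can only decrease at a rate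
controlled by how far it lies below one of its earlier values, then it does not fall below its
initial value. -/
theorem AbsolutelyContinuousOnInterval.initial_le_of_neg_deriv_le {q : ℝ → ℝ} {T S κ : ℝ}
    (hTS : T ≤ S) (hκ : 0 < κ) (hq : AbsolutelyContinuousOnInterval q T S)
    (h : ∀ᵐ t, t ∈ Icc T S → ∃ r ∈ Icc T t, -deriv q t ≤ κ * max (q r - q t) 0) :
    q T ≤ q S := by
  have hqc : ContinuousOn q (Icc T S) := by simpa [uIcc_of_le hTS] using hq.continuousOn
  set E : ℝ → ℝ := fun t => Real.exp (2 * κ * (t - T)) with hE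
  have hEpos : ∀ t, 0 < E t := fun t => Real.exp_pos _
  have hEc : Continuous E := by simp only [hE]; fun_prop
  set P : Set (ℝ × ℝ) := (Icc T S ×ˢ Icc T S) ∩ {p | p.1 ≤ p.2} with hP
  have hPc : IsCompact P :=
    (isCompact_Icc.prod isCompact_Icc).inter_right (isClosed_le continuous_fst continuous_snd)
  have hPne : P.Nonempty := ⟨(T, T), ⟨⟨⟨le_rfl, hTS⟩, ⟨le_rfl, hTS⟩⟩, le_refl T⟩⟩
  have hcont : ContinuousOn (fun p : ℝ × ℝ => (q p.1 - q p.2) / E p.2) P := by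
    refine ContinuousOn.div ?_ (hEc.comp continuous_snd).continuousOn fun p _ => (hEpos _).ne'
    refine (hqc.comp continuousOn_fst ?_).sub (hqc.comp continuousOn_snd ?_)
    · exact fun p hp => hp.1.1
    · exact fun p hp => hp.1.2
  obtain ⟨⟨r, t⟩, hrt, hmax⟩ := hPc.exists_isMaxOn hPne hcont
  set Δ := (q r - q t) / E t with hΔ
  have hle : ∀ r' t', T ≤ r' → r' ≤ t' → t' ≤ S → q r' - q t' ≤ Δ * E t' := by
    intro r' t' h1 h2 h3
    have := hmax (show (r', t') ∈ P from ⟨⟨⟨h1, h2.trans h3⟩, ⟨h1.trans h2, h3⟩⟩, h2⟩)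
    simp only [mem_ofPred_eq] at this
    rwa [div_le_iff₀ (hEpos _)] at this
  have hΔ0 : 0 ≤ Δ := by
    have := hle T T le_rfl le_rfl hTS
    simp only [sub_self] at this
    exact nonneg_of_mul_nonneg_left this (hEpos _)
  have hTr : T ≤ r := hrt.1.1.1
  have hrt' : r ≤ t := hrt.2
  have htS : t ≤ S := hrt.1.2.2
  have hsub : uIcc r t ⊆ uIcc T S := by
    rw [uIcc_of_le hrt', uIcc_of_le hTS]; exact Icc_subset_Icc hTr htS
  have key := (hq.mono hsub).fun_neg.sub_le_integral_of_deriv_le hrt'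
    (F := fun s => κ * Δ * E s) ((hEc.const_mul _).intervalIntegrable _ _) (by
      filter_upwards [h] with s hs hsr
      obtain ⟨r', hr', hd⟩ := hs ⟨hTr.trans hsr.1, hsr.2.trans htS⟩
      rw [deriv.fun_neg, mul_assoc]
      refine hd.trans (mul_le_mul_of_nonneg_left (max_le ?_ ?_) hκ.le)
      · exact hle r' s hr'.1 hr'.2 (hsr.2.trans htS)
      · exact mul_nonneg hΔ0 (hEpos _).le)
  rw [intervalIntegral.integral_const_mul, hE,
    integral_exp_mul_sub (by positivity : (2 * κ) ≠ 0)] at key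
  have e1 : q r - q t = Δ * E t := by rw [hΔ, div_mul_cancel₀ _ (hEpos t).ne']
  have e2 : κ * Δ * ((E t - E r) / (2 * κ)) = Δ * (E t - E r) / 2 := by field_simp
  have hΔle : Δ ≤ 0 := by
    change -q t - -q r ≤ κ * Δ * ((E t - E r) / (2 * κ)) at key
    rw [e2] at key
    by_contra hcon
    push Not at hcon
    nlinarith [mul_pos hcon (hEpos t), mul_pos hcon (hEpos r)]
  have := hle T S le_rfl hTS le_rfl
  nlinarith [hEpos S]

/-- Comparison principle for `y'(t) + a(t) y(g(t)) ≥ 0`, relative to a positive solution `z` of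
the corresponding equation. -/
theorem nonneg_of_neg_deriv_le_delay {a g z y : ℝ → ℝ} {t₀ T S A : ℝ} (hT : t₀ ≤ T) (hTS : T ≤ S)
    (hz : AbsolutelyContinuousOnInterval z t₀ S) (hzpos : ∀ t ∈ Icc t₀ S, 0 < z t)
    (hz0 : ∀ t < t₀, z t = 0)
    (hzeq : ∀ᵐ t, t₀ ≤ t → DifferentiableAt ℝ z t ∧ deriv z t + a t * z (g t) = 0)
    (ha : ∀ᵐ t, t₀ ≤ t → 0 ≤ a t ∧ a t ≤ A)
    (hgt : ∀ t, t₀ ≤ t → g t ≤ t) (hg : ∀ t, T ≤ t → t₀ ≤ g t)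
    (hy : AbsolutelyContinuousOnInterval y T S) (hyT : 0 ≤ y T)
    (h : ∀ᵐ t, t ∈ Icc T S → -deriv y t ≤ a t * y (if T ≤ g t then g t else T)) : 0 ≤ y S := by
  have htS : t₀ ≤ S := hT.trans hTS
  have hzc : ContinuousOn z (Icc t₀ S) := by simpa [uIcc_of_le htS] using hz.continuousOn
  have hanti : ∀ r t, t₀ ≤ r → r ≤ t → t ≤ S → z t ≤ z r := by
    intro r t h1 h2 h3
    have := (hz.mono (c := r) (d := t) (by
      rw [uIcc_of_le h2, uIcc_of_le htS]; exact Icc_subset_Icc h1 h3)).sub_le_integral_of_deriv_le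
      h2 (F := fun _ => 0) (by simp) (by
        filter_upwards [hzeq, ha] with s hs has hsr
        have e := (hs (h1.trans hsr.1)).2
        have : 0 ≤ a s * z (g s) := by
          refine mul_nonneg (has (h1.trans hsr.1)).1 ?_
          rcases lt_or_ge (g s) t₀ with hlt | hge
          · rw [hz0 _ hlt]
          · exact (hzpos _ ⟨hge, (hgt s (h1.trans hsr.1)).trans (hsr.2.trans h3)⟩).le
        linarith)
    simpa using this
  have hzS : 0 < z S := hzpos S ⟨htS, le_rfl⟩
  have hzt₀ : 0 < z t₀ := hzpos t₀ ⟨le_rfl, htS⟩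
  have hsub : uIcc T S ⊆ uIcc t₀ S := by
    rw [uIcc_of_le hTS, uIcc_of_le htS]; exact Icc_subset_Icc hT le_rfl
  have hzi : AbsolutelyContinuousOnInterval (fun t => (z t)⁻¹) T S := by
    refine (hz.mono hsub).fun_inv_of_le_abs hzS fun t ht => ?_
    rw [uIcc_of_le hTS] at ht
    exact (hanti t S (hT.trans ht.1) ht.2 le_rfl).trans (le_abs_self _)
  have hq := hy.fun_mul hzi
  set κ : ℝ := (|A| + 1) * (z t₀ / z S) with hκ
  have hκpos : 0 < κ := by positivity
  have key := hq.initial_le_of_neg_deriv_le hTS hκpos (by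
    filter_upwards [hzeq, ha, h, hy.ae_differentiableAt] with t e1 e2 e3 e4 ht
    have ht0 : t₀ ≤ t := hT.trans ht.1
    obtain ⟨hzd, hze⟩ := e1 ht0
    obtain ⟨ha0, haA⟩ := e2 ht0
    have hyd := e4 (by rwa [uIcc_of_le hTS])
    have hyle := e3 ht
    have hzt : 0 < z t := hzpos t ⟨ht0, ht.2⟩
    have hg0 := hg t ht.1
    have hgle := hgt t ht0
    have hzg : 0 < z (g t) := hzpos _ ⟨hg0, hgle.trans ht.2⟩
    set r := if T ≤ g t then g t else T with hr
    have hrmem : r ∈ Icc T t := by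
      rw [hr]; split_ifs with hc
      · exact ⟨hc, hgle⟩
      · exact ⟨le_rfl, ht.1⟩
    have hzr : 0 < z r := hzpos r ⟨hT.trans hrmem.1, hrmem.2.trans ht.2⟩
    have hrz : y r * (z r)⁻¹ * z r ≤ y r * (z r)⁻¹ * z (g t) := by
      rw [hr]; split_ifs with hc
      · exact le_rfl
      · push Not at hc
        exact mul_le_mul_of_nonneg_left (hanti _ _ hg0 hc.le hTS)
          (mul_nonneg hyT (inv_nonneg.2 (hanti T S hT hTS le_rfl |> hzS.le.trans)))
    refine ⟨r, hrmem, ?_⟩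
    have hd := (hyd.hasDerivAt.fun_mul (hzd.hasDerivAt.fun_inv hzt.ne')).deriv
    rw [hd]
    have hk : a t * z (g t) / z t ≤ κ := by
      rw [hκ, mul_div_assoc]
      refine mul_le_mul (haA.trans ((le_abs_self A).trans (by linarith))) ?_ (by positivity)
        (by positivity)
      exact div_le_div₀ hzt₀.le (hanti _ _ le_rfl hg0 (hgle.trans ht.2)) hzS
        (hanti _ _ ht0 ht.2 le_rfl)
    have hk0 : 0 ≤ a t * z (g t) / z t := by positivity
    calc -(deriv y t * (z t)⁻¹ + y t * (-deriv z t / z t ^ 2))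
        = (-deriv y t) * (z t)⁻¹ - a t * z (g t) / z t * (y t * (z t)⁻¹) := by
          have : deriv z t = -(a t * z (g t)) := by linarith
          rw [this]; field_simp; ring
      _ ≤ (a t * y r) * (z t)⁻¹ - a t * z (g t) / z t * (y t * (z t)⁻¹) := by
          gcongr
      _ = a t * (y r * (z r)⁻¹ * z r) * (z t)⁻¹ - a t * z (g t) / z t * (y t * (z t)⁻¹) := by
          field_simp
      _ ≤ a t * (y r * (z r)⁻¹ * z (g t)) * (z t)⁻¹
            - a t * z (g t) / z t * (y t * (z t)⁻¹) := by
          gcongr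
      _ = a t * z (g t) / z t * (y r * (z r)⁻¹ - y t * (z t)⁻¹) := by field_simp
      _ ≤ a t * z (g t) / z t * max (y r * (z r)⁻¹ - y t * (z t)⁻¹) 0 := by
          gcongr
          exact le_max_left _ _
      _ ≤ κ * max (y r * (z r)⁻¹ - y t * (z t)⁻¹) 0 := by
          gcongr)
  have h1 : 0 ≤ y S * (z S)⁻¹ :=
    (mul_nonneg hyT (inv_nonneg.2 (hzpos T ⟨hT, hTS⟩).le)).trans key
  exact (mul_nonneg_iff_of_pos_right (inv_pos.2 hzS)).1 h1

/-- `x`, with derivative `v`, solves `x'' + a x' + b x = f` almost everywhere on `[s, ∞)`. -/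
structure IsForcedSolution (a b f : ℝ → ℝ) (s : ℝ) (x v : ℝ → ℝ) : Prop where
  hasDeriv : ∀ t, s ≤ t → HasDerivWithinAt x (v t) (Ici s) t
  absolutelyContinuous : ∀ T, s ≤ T → AbsolutelyContinuousOnInterval v s T
  equation : ∀ᵐ t, s ≤ t →
    DifferentiableAt ℝ v t ∧ deriv v t = -(a t * v t) - b t * x t + f t

namespace IsDelaySolution

variable {a b g h φ ψ x v : ℝ → ℝ} {s x₀ x₁ : ℝ}

theorem equation_ae (hx : IsDelaySolution a b g h s φ ψ x₀ x₁ x v) :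
    ∀ᵐ t, s ≤ t → DifferentiableAt ℝ v t ∧ deriv v t + a t * v (g t) + b t * x (h t) = 0 :=
  (ae_restrict_iff' measurableSet_Ici).1 hx.equation

theorem isForcedSolution (hx : IsDelaySolution a b g h s φ ψ x₀ x₁ x v) :
    IsForcedSolution a b (fun t => a t * (v t - v (g t)) + b t * (x t - x (h t))) s x v where
  hasDeriv := hx.hasDeriv
  absolutelyContinuous := hx.absolutelyContinuous
  equation := by
    filter_upwards [hx.equation_ae] with t ht hst
    exact ⟨(ht hst).1, by linarith [(ht hst).2]⟩

theorem isForcedSolution_zero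
    (hx : IsDelaySolution a b (fun t => t) (fun t => t) s φ ψ x₀ x₁ x v) :
    IsForcedSolution a b (fun _ => 0) s x v := by
  simpa using hx.isForcedSolution

end IsDelaySolution

namespace IsForcedSolution

variable {a b f p p' r r' x v : ℝ → ℝ} {s T : ℝ}

theorem mono (hx : IsForcedSolution a b f s x v) (hT : s ≤ T) : IsForcedSolution a b f T x v where
  hasDeriv t ht := (hx.hasDeriv t (hT.trans ht)).mono (Ici_subset_Ici.2 hT)
  absolutelyContinuous S hS := (hx.absolutelyContinuous S (hT.trans hS)).mono (by
    rw [uIcc_of_le hS, uIcc_of_le (hT.trans hS)]; exact Icc_subset_Icc hT le_rfl)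
  equation := by
    filter_upwards [hx.equation] with t ht hst using ht (hT.trans hst)

theorem continuousOn_deriv (hx : IsForcedSolution a b f s x v) : ContinuousOn v (Ici s) := by
  intro t ht
  have h1 := (hx.absolutelyContinuous (t + 1) (by linarith [mem_Ici.1 ht])).continuousOn
  rw [uIcc_of_le (by linarith [mem_Ici.1 ht])] at h1
  have hmem : Icc s (t + 1) ∈ nhdsWithin t (Ici s) := by
    rw [← Ici_inter_Iic]
    exact Filter.inter_mem self_mem_nhdsWithin (mem_nhdsWithin_of_mem_nhds (Iic_mem_nhds (by linarith)))
  exact (h1 t ⟨ht, by linarith⟩).mono_of_mem_nhdsWithin hmem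

theorem continuousOn (hx : IsForcedSolution a b f s x v) : ContinuousOn x (Ici s) :=
  fun t ht => (hx.hasDeriv t ht).continuousWithinAt

theorem absolutelyContinuousOnInterval (hx : IsForcedSolution a b f s x v) (hT : s ≤ T) :
    AbsolutelyContinuousOnInterval x s T := by
  have hsub : uIcc s T ⊆ Ici s := by rw [uIcc_of_le hT]; exact Icc_subset_Ici_self
  exact absolutelyContinuousOnInterval_of_hasDerivWithinAt
    (fun t ht => (hx.hasDeriv t (hsub ht)).mono hsub) (hx.continuousOn_deriv.mono hsub)

theorem hasDerivAt (hx : IsForcedSolution a b f s x v) {t : ℝ} (ht : s < t) :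
    HasDerivAt x (v t) t :=
  (hx.hasDeriv t ht.le).hasDerivAt (Ici_mem_nhds ht)

theorem ae_hasDerivAt (hx : IsForcedSolution a b f s x v) :
    ∀ᵐ t, s ≤ t → HasDerivAt x (v t) t ∧
      HasDerivAt v (-(a t * v t) - b t * x t + f t) t := by
  filter_upwards [hx.equation, Measure.ae_ne volume s] with t ht hts hst
  refine ⟨hx.hasDerivAt (lt_of_le_of_ne hst (Ne.symm hts)), ?_⟩
  rw [← (ht hst).2]
  exact (ht hst).1.hasDerivAt

/-- Superposition of two solutions of the homogeneous equation. -/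
theorem linear_combination (hp : IsForcedSolution a b (fun _ => 0) s p p')
    (hr : IsForcedSolution a b (fun _ => 0) s r r') (c d : ℝ) :
    IsForcedSolution a b (fun _ => 0) s (fun t => c * p t + d * r t)
      (fun t => c * p' t + d * r' t) where
  hasDeriv t ht := ((hp.hasDeriv t ht).const_mul c).fun_add ((hr.hasDeriv t ht).const_mul d)
  absolutelyContinuous S hS := ((hp.absolutelyContinuous S hS).const_mul c).fun_add
    ((hr.absolutelyContinuous S hS).const_mul d)
  equation := by
    filter_upwards [hp.ae_hasDerivAt, hr.ae_hasDerivAt] with t h1 h2 hst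
    have := (((h1 hst).2.const_mul c).fun_add ((h2 hst).2.const_mul d))
    refine ⟨this.differentiableAt, ?_⟩
    rw [this.deriv]; ring

/-- A solution of the homogeneous equation, cut off before its initial point. -/
theorem isDelaySolution_cutoff (hx : IsForcedSolution a b (fun _ => 0) s x v) :
    IsDelaySolution a b (fun t => t) (fun t => t) s (fun _ => 0) (fun _ => 0) (x s) (v s)
      (fun t => if t < s then 0 else x t) (fun t => if t < s then 0 else v t) where
  prehistory t ht := if_pos ht
  prehistory_deriv t ht := if_pos ht
  initial := if_neg (lt_irrefl s)
  initial_deriv := if_neg (lt_irrefl s)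
  hasDeriv t ht := by
    rw [if_neg (not_lt.2 ht)]
    exact (hx.hasDeriv t ht).congr (fun y hy => if_neg (not_lt.2 hy)) (if_neg (not_lt.2 ht))
  absolutelyContinuous S hS := by
    refine (hx.absolutelyContinuous S hS).congr_of_eqOn fun t ht => ?_
    rw [uIcc_of_le hS] at ht
    exact (if_neg (not_lt.2 ht.1)).symm
  equation := by
    rw [ae_restrict_iff' measurableSet_Ici]
    filter_upwards [hx.equation, Measure.ae_ne volume s] with t ht hts hst
    have hlt : s < t := lt_of_le_of_ne hst (Ne.symm hts)
    have heq : (fun t => if t < s then 0 else v t) =ᶠ[nhds t] v := by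
      filter_upwards [Ioi_mem_nhds hlt] with y hy using if_neg (not_lt.2 (le_of_lt hy))
    refine ⟨heq.differentiableAt_iff.2 (ht hst).1, ?_⟩
    rw [heq.deriv_eq, if_neg (not_lt.2 hst), if_neg (not_lt.2 hst), (ht hst).2]
    ring

theorem wronskian_absolutelyContinuous (hp : IsForcedSolution a b (fun _ => 0) s p p')
    (hx : IsForcedSolution a b f s x v) (hT : s ≤ T) :
    AbsolutelyContinuousOnInterval (fun t => p t * v t - p' t * x t) s T :=
  ((hp.absolutelyContinuousOnInterval hT).fun_mul (hx.absolutelyContinuous T hT)).fun_sub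
    ((hp.absolutelyContinuous T hT).fun_mul (hx.absolutelyContinuousOnInterval hT))

theorem ae_hasDerivAt_wronskian (hp : IsForcedSolution a b (fun _ => 0) s p p')
    (hx : IsForcedSolution a b f s x v) :
    ∀ᵐ t, s ≤ t → HasDerivAt (fun t => p t * v t - p' t * x t)
      (-(a t * (p t * v t - p' t * x t)) + p t * f t) t := by
  filter_upwards [hp.ae_hasDerivAt, hx.ae_hasDerivAt] with t h1 h2 hst
  have := ((h1 hst).1.fun_mul (h2 hst).2).fun_sub ((h1 hst).2.fun_mul (h2 hst).1)
  convert! this using 1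
  ring

theorem wronskian_ne_zero {A : ℝ} (ha : ∀ᵐ t, s ≤ t → |a t| ≤ A)
    (hp : IsForcedSolution a b (fun _ => 0) s p p')
    (hr : IsForcedSolution a b (fun _ => 0) s r r') (h0 : p s * r' s - p' s * r s ≠ 0)
    (hT : s ≤ T) : p T * r' T - p' T * r T ≠ 0 := by
  have hW := hp.wronskian_absolutelyContinuous hr hT
  have hE : AbsolutelyContinuousOnInterval (fun t => Real.exp (2 * A * t)) s T :=
    ContDiffOn.absolutelyContinuousOnInterval (by fun_prop)
  have key := (((hW.fun_mul hW).fun_mul hE).fun_neg).sub_le_integral_of_deriv_le hT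
    (F := fun _ => 0) (by simp) (by
      filter_upwards [hp.ae_hasDerivAt_wronskian hr, ha] with t ht hat hts
      have d1 := ht hts.1
      have d2 : HasDerivAt (fun t => Real.exp (2 * A * t)) (Real.exp (2 * A * t) * (2 * A)) t := by
        have : HasDerivAt (fun t => 2 * A * t) (2 * A) t := by
          simpa using (hasDerivAt_id t).const_mul (2 * A)
        exact this.exp
      rw [((d1.fun_mul d1).fun_mul d2).fun_neg.deriv]
      have h1 : 0 ≤ (A - a t) * ((p t * r' t - p' t * r t) ^ 2 * Real.exp (2 * A * t)) := by
        refine mul_nonneg ?_ (by positivity)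
        linarith [le_abs_self (a t), hat hts.1]
      nlinarith)
  simp only [intervalIntegral.integral_zero] at key
  intro hzero
  rw [hzero] at key
  have : 0 < (p s * r' s - p' s * r s) * (p s * r' s - p' s * r s) * Real.exp (2 * A * s) :=
    mul_pos (mul_self_pos.2 h0) (Real.exp_pos _)
  linarith

end IsForcedSolution

section VariationOfConstants

variable {a b f p p' r r' x v : ℝ → ℝ} {s T S A : ℝ}

theorem IsForcedSolution.absolutelyContinuous_wronskian_div
    (ha : ∀ᵐ t, s ≤ t → |a t| ≤ A)
    (hp : IsForcedSolution a b (fun _ => 0) s p p')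
    (hr : IsForcedSolution a b (fun _ => 0) s r r') (h0 : p s * r' s - p' s * r s ≠ 0)
    {q q' : ℝ → ℝ} (hq : IsForcedSolution a b (fun _ => 0) s q q')
    (hx : IsForcedSolution a b f T x v) (hT : s ≤ T) (hTS : T ≤ S) :
    AbsolutelyContinuousOnInterval
      (fun t => (q t * v t - q' t * x t) * (p t * r' t - p' t * r t)⁻¹) T S ∧
    ∀ᵐ t, t ∈ Icc T S → HasDerivAt
      (fun t => (q t * v t - q' t * x t) * (p t * r' t - p' t * r t)⁻¹)
      (q t * f t * (p t * r' t - p' t * r t)⁻¹) t := by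
  have hne : ∀ t, s ≤ t → p t * r' t - p' t * r t ≠ 0 := fun t ht =>
    hp.wronskian_ne_zero ha hr h0 ht
  constructor
  · refine ((hq.mono hT).wronskian_absolutelyContinuous hx hTS).fun_mul ?_
    have hW := (hp.mono hT).wronskian_absolutelyContinuous (hr.mono hT) hTS
    obtain ⟨t', ht', hmin⟩ := isCompact_uIcc.exists_isMinOn nonempty_uIcc hW.continuousOn.abs
    rw [uIcc_of_le hTS] at ht'
    exact hW.fun_inv_of_le_abs (abs_pos.2 (hne t' (hT.trans ht'.1))) fun t ht => hmin ht
  · filter_upwards [(hq.mono hT).ae_hasDerivAt_wronskian hx,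
      (hp.mono hT).ae_hasDerivAt_wronskian (hr.mono hT)] with t h1 h2 ht
    have hn := hne t (hT.trans ht.1)
    have := (h1 ht.1).fun_mul ((h2 ht.1).fun_inv hn)
    convert! this using 1
    field_simp
    ring

theorem IsForcedSolution.abs_sub_le_of_wronskian_ne_zero
    (ha : ∀ᵐ t, s ≤ t → |a t| ≤ A)
    (hp : IsForcedSolution a b (fun _ => 0) s p p')
    (hr : IsForcedSolution a b (fun _ => 0) s r r') (h0 : p s * r' s - p' s * r s ≠ 0)
    (hx : IsForcedSolution a b f T x v) (hT : s ≤ T) (hTS : T ≤ S)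
    {F : ℝ → ℝ} (hF : Continuous F) (hfF : ∀ᵐ t, t ∈ Icc T S → |f t| ≤ F t) :
    |x S - (-((r T * v T - r' T * x T) * (p T * r' T - p' T * r T)⁻¹) * p S +
        (p T * v T - p' T * x T) * (p T * r' T - p' T * r T)⁻¹ * r S)| ≤
      ∫ t in T..S, |(p t * r S - r t * p S) * (p t * r' t - p' t * r t)⁻¹| * F t := by
  have hne : ∀ t, s ≤ t → p t * r' t - p' t * r t ≠ 0 := fun t ht =>
    hp.wronskian_ne_zero ha hr h0 ht
  obtain ⟨hA, hA'⟩ := IsForcedSolution.absolutelyContinuous_wronskian_div ha hp hr h0 hp hx hT hTS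
  obtain ⟨hB, hB'⟩ := IsForcedSolution.absolutelyContinuous_wronskian_div ha hp hr h0 hr hx hT hTS
  have hsub : uIcc T S ⊆ Ici s := by
    rw [uIcc_of_le hTS]; exact fun t ht => hT.trans ht.1
  have key := ((hA.const_mul (r S)).fun_sub (hB.const_mul (p S))).abs_sub_le_integral_of_abs_deriv_le
    hTS (F := fun t => |(p t * r S - r t * p S) * (p t * r' t - p' t * r t)⁻¹| * F t) (by
      refine ContinuousOn.intervalIntegrable ?_
      have c1 := hp.continuousOn.mono hsub
      have c2 := hp.continuousOn_deriv.mono hsub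
      have c3 := hr.continuousOn.mono hsub
      have c4 := hr.continuousOn_deriv.mono hsub
      refine ContinuousOn.mul (ContinuousOn.abs (ContinuousOn.mul (by fun_prop) ?_))
        hF.continuousOn
      exact ContinuousOn.inv₀ (by fun_prop) fun t ht => hne t (hsub ht)) (by
      filter_upwards [hA', hB', hfF] with t h1 h2 h3 ht
      rw [(((h1 ht).const_mul (r S)).fun_sub ((h2 ht).const_mul (p S))).deriv]
      have : r S * (p t * f t * (p t * r' t - p' t * r t)⁻¹) -
          p S * (r t * f t * (p t * r' t - p' t * r t)⁻¹) =
          (p t * r S - r t * p S) * (p t * r' t - p' t * r t)⁻¹ * f t := by ring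
      rw [this, abs_mul]
      exact mul_le_mul_of_nonneg_left (h3 ht) (abs_nonneg _))
  convert key using 2
  have hn := hne S (hT.trans hTS)
  have e : x S = r S * ((p S * v S - p' S * x S) * (p S * r' S - p' S * r S)⁻¹) -
      p S * ((r S * v S - r' S * x S) * (p S * r' S - p' S * r S)⁻¹) := by
    linear_combination -(x S) * mul_inv_cancel₀ hn
  rw [← e]
  ring

end VariationOfConstants

/-- Two linearly independent solutions, and the expression of the fundamental function through
them. -/
theorem IsFundamentalFunction.exists_wronskian_ne_zero {a b : ℝ → ℝ} {Y : ℝ → ℝ → ℝ} {A : ℝ}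
    (ha : ∀ᵐ t, 0 ≤ t → |a t| ≤ A)
    (hY : IsFundamentalFunction a b (fun t => t) (fun t => t) Y) :
    ∃ s, 0 < s ∧ s ≤ 1 ∧ ∃ p p' r r', IsForcedSolution a b (fun _ => 0) s p p' ∧
      IsForcedSolution a b (fun _ => 0) s r r' ∧ p s * r' s - p' s * r s ≠ 0 ∧
      ∀ t σ, s ≤ σ → σ ≤ t →
        Y t σ = (p σ * r t - r σ * p t) * (p σ * r' σ - p' σ * r σ)⁻¹ := by
  obtain ⟨p', hp⟩ := hY 0 le_rfl
  have hpf := hp.isForcedSolution_zero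
  obtain ⟨s, hs0, hs1, hps⟩ : ∃ s, 0 < s ∧ s ≤ 1 ∧ Y s 0 ≠ 0 := by
    have hd := hp.hasDeriv 0 le_rfl
    rw [hp.initial_deriv] at hd
    have hne := hd.eventually_ne (c := 0) one_ne_zero
    have hmem : Ioc (0 : ℝ) 1 ∈ nhdsWithin 0 (Ici 0 \ {0}) := by
      rw [Ici_sdiff_left]
      exact Ioc_mem_nhdsGT one_pos
    have hne' : (nhdsWithin (0 : ℝ) (Ici 0 \ {0})).NeBot := by
      rw [Ici_sdiff_left]; infer_instance
    obtain ⟨s, h1, h2⟩ := (hne.and hmem).exists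
    exact ⟨s, h2.1, h2.2, h1⟩
  obtain ⟨r', hr⟩ := hY s hs0.le
  have hrf := hr.isForcedSolution_zero
  have hpf' := hpf.mono hs0.le
  have h0 : Y s 0 * r' s - p' s * Y s s ≠ 0 := by
    rw [hr.initial, hr.initial_deriv]; simpa using hps
  refine ⟨s, hs0, hs1, fun t => Y t 0, p', fun t => Y t s, r', hpf', hrf, h0, ?_⟩
  intro t σ hσ hσt
  have ha' : ∀ᵐ t, s ≤ t → |a t| ≤ A := by
    filter_upwards [ha] with t ht hst using ht (hs0.le.trans hst)
  obtain ⟨w, hw⟩ := hY σ (hs0.le.trans hσ)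
  have key := IsForcedSolution.abs_sub_le_of_wronskian_ne_zero ha' hpf' hrf h0
    hw.isForcedSolution_zero hσ hσt (F := fun _ => 0) continuous_const (by simp)
  simp only [mul_zero, intervalIntegral.integral_zero] at key
  have e := sub_eq_zero.1 (abs_eq_zero.1 (le_antisymm key (abs_nonneg _)))
  rw [e, hw.initial, hw.initial_deriv]
  ring

/-- Variation of constants estimate: the contribution of the initial data is estimated by exponential
stability, that of the right-hand side by the fundamental function. -/
theorem abs_le_of_isForcedSolution {a b : ℝ → ℝ} {Y : ℝ → ℝ → ℝ} {A M μ : ℝ}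
    (ha : ∀ᵐ t, 0 ≤ t → |a t| ≤ A)
    (hY : IsFundamentalFunction a b (fun t => t) (fun t => t) Y)
    (hM : ∀ t₀ : ℝ, 0 ≤ t₀ → ∀ (x₀ x₁ : ℝ) (x v : ℝ → ℝ),
      IsDelaySolution a b (fun t => t) (fun t => t) t₀ (fun _ => 0) (fun _ => 0) x₀ x₁ x v →
        ∀ t, t₀ ≤ t → |x t| ≤ M * Real.exp (-μ * (t - t₀)) * (|x₀| + |x₁|))
    {f x v : ℝ → ℝ} {T S : ℝ} (hT : 1 ≤ T) (hTS : T ≤ S) (hx : IsForcedSolution a b f T x v)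
    {F : ℝ → ℝ} (hF : Continuous F) (hfF : ∀ᵐ t, t ∈ Icc T S → |f t| ≤ F t) :
    ContinuousOn (Y S) (Icc T S) ∧
    |x S| ≤ M * Real.exp (-μ * (S - T)) * (|x T| + |v T|) + ∫ t in T..S, |Y S t| * F t := by
  obtain ⟨s, hs0, hs1, p, p', r, r', hp, hr, h0, hYeq⟩ := hY.exists_wronskian_ne_zero ha
  have hsT : s ≤ T := hs1.trans hT
  have ha' : ∀ᵐ t, s ≤ t → |a t| ≤ A := by
    filter_upwards [ha] with t ht hst using ht (hs0.le.trans hst)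
  have hne : ∀ t, s ≤ t → p t * r' t - p' t * r t ≠ 0 := fun t ht =>
    hp.wronskian_ne_zero ha' hr h0 ht
  constructor
  · have hsub : Icc T S ⊆ Ici s := fun t ht => hsT.trans ht.1
    have c1 := hp.continuousOn.mono hsub
    have c2 := hp.continuousOn_deriv.mono hsub
    have c3 := hr.continuousOn.mono hsub
    have c4 := hr.continuousOn_deriv.mono hsub
    refine ContinuousOn.congr ?_ fun t ht => hYeq S t (hsub ht) ht.2
    refine ContinuousOn.mul (by fun_prop) ?_
    exact ContinuousOn.inv₀ (by fun_prop) fun t ht => hne t (hsub ht)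
  have key := IsForcedSolution.abs_sub_le_of_wronskian_ne_zero ha' hp hr h0 hx hsT hTS hF hfF
  have hhom := ((hp.mono hsT).linear_combination (hr.mono hsT)
    (-((r T * v T - r' T * x T) * (p T * r' T - p' T * r T)⁻¹))
    ((p T * v T - p' T * x T) * (p T * r' T - p' T * r T)⁻¹)).isDelaySolution_cutoff
  have hb := hM T (zero_le_one.trans hT) _ _ _ _ hhom S hTS
  have hn := hne T hsT
  simp only [if_neg (not_lt.2 hTS)] at hb
  have e1 : -((r T * v T - r' T * x T) * (p T * r' T - p' T * r T)⁻¹) * p T +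
      (p T * v T - p' T * x T) * (p T * r' T - p' T * r T)⁻¹ * r T = x T := by
    linear_combination x T * mul_inv_cancel₀ hn
  have e2 : -((r T * v T - r' T * x T) * (p T * r' T - p' T * r T)⁻¹) * p' T +
      (p T * v T - p' T * x T) * (p T * r' T - p' T * r T)⁻¹ * r' T = v T := by
    linear_combination v T * mul_inv_cancel₀ hn
  rw [e1, e2] at hb
  have e3 : ∫ t in T..S, |Y S t| * F t =
      ∫ t in T..S, |(p t * r S - r t * p S) * (p t * r' t - p' t * r t)⁻¹| * F t := by
    refine intervalIntegral.integral_congr fun t ht => ?_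
    rw [uIcc_of_le hTS] at ht
    simp only [hYeq S t (hsT.trans ht.1) ht.2]
  rw [e3]
  have := abs_sub_abs_le_abs_sub (x S) (-((r T * v T - r' T * x T) *
    (p T * r' T - p' T * r T)⁻¹) * p S +
    (p T * v T - p' T * x T) * (p T * r' T - p' T * r T)⁻¹ * r S)
  linarith

theorem supIntegral_ne_top {Y : ℝ → ℝ → ℝ} {M μ t₀ : ℝ} (ht₀ : 0 ≤ t₀) (hM : 0 < M) (hμ : 0 < μ)
    (hY : ∀ σ t, 0 ≤ σ → σ ≤ t → |Y t σ| ≤ M * Real.exp (-μ * (t - σ))) :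
    supIntegral t₀ Y ≠ ⊤ := by
  refine ne_top_of_le_ne_top (ENNReal.ofReal_ne_top (r := M / μ)) (iSup₂_le fun t ht => ?_)
  have ht' : t₀ ≤ t := le_of_lt ht
  have hc : Continuous fun σ => M * Real.exp (μ * (σ - t)) := by fun_prop
  calc ∫⁻ s in Icc t₀ t, ENNReal.ofReal |Y t s|
      ≤ ∫⁻ s in Icc t₀ t, ENNReal.ofReal (M * Real.exp (μ * (s - t))) := by
        refine setLIntegral_mono' measurableSet_Icc fun s hs => ENNReal.ofReal_le_ofReal ?_
        refine (hY s t (ht₀.trans hs.1) hs.2).trans_eq ?_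
        congr 2; ring
    _ = ENNReal.ofReal (∫ s in Icc t₀ t, M * Real.exp (μ * (s - t))) := by
        rw [ofReal_integral_eq_lintegral_ofReal]
        · exact hc.continuousOn.integrableOn_Icc
        · exact Filter.Eventually.of_forall fun s => by positivity
    _ ≤ ENNReal.ofReal (M / μ) := by
        refine ENNReal.ofReal_le_ofReal ?_
        rw [integral_Icc_eq_integral_Ioc, ← intervalIntegral.integral_of_le ht',
          intervalIntegral.integral_const_mul, integral_exp_mul_sub hμ.ne', mul_div_assoc' M]
        gcongr
        have := Real.exp_pos (μ * (t₀ - t))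
        simp only [sub_self, mul_zero, Real.exp_zero]
        nlinarith

theorem integral_abs_le_supIntegral {Y : ℝ → ℝ → ℝ} {t₀ T S : ℝ} (hT : t₀ < T) (hTS : T ≤ S)
    (hfin : supIntegral t₀ Y ≠ ⊤) (hc : ContinuousOn (Y S) (Icc T S)) :
    ∫ t in T..S, |Y S t| ≤ (supIntegral t₀ Y).toReal := by
  rw [intervalIntegral.integral_of_le hTS, ← integral_Icc_eq_integral_Ioc,
    ← ENNReal.ofReal_le_iff_le_toReal hfin,
    ofReal_integral_eq_lintegral_ofReal hc.abs.integrableOn_Icc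
      (Filter.Eventually.of_forall fun s => abs_nonneg _)]
  refine (lintegral_mono_set (Icc_subset_Icc hT.le le_rfl)).trans ?_
  exact le_iSup₂ (f := fun t (_ : t ∈ Ioi t₀) => ∫⁻ s in Icc t₀ t, ENNReal.ofReal |Y t s|) S
    (hT.trans_le hTS)

/-- The exponentially weighted kernel estimate. -/
theorem integral_abs_mul_exp_le {Y : ℝ → ℝ → ℝ} {M μ l t₀ T S : ℝ} (ht₀ : 0 ≤ t₀) (hT : t₀ < T)
    (hTS : T ≤ S) (hM : 0 < M) (hl : 0 ≤ l) (hlμ : l < μ)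
    (hY : ∀ σ t, 0 ≤ σ → σ ≤ t → |Y t σ| ≤ M * Real.exp (-μ * (t - σ)))
    (hc : ContinuousOn (Y S) (Icc T S)) :
    ∫ t in T..S, |Y S t| * Real.exp (-l * (t - T)) ≤
      Real.exp (-l * (S - T)) * ((supIntegral t₀ Y).toReal + M * (1 / (μ - l) - 1 / μ)) := by
  have hμ : 0 < μ := hl.trans_lt hlμ
  have hμl : 0 < μ - l := sub_pos.2 hlμ
  have hint : IntervalIntegrable (fun t => |Y S t|) volume T S := by
    refine ContinuousOn.intervalIntegrable ?_
    rw [uIcc_of_le hTS]; exact hc.abs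
  have hexp : Continuous fun t => M * Real.exp ((μ - l) * (t - S)) - M * Real.exp (μ * (t - S)) := by
    fun_prop
  have h1 : ∫ t in T..S, |Y S t| * Real.exp (-l * (t - T)) ≤
      ∫ t in T..S, Real.exp (-l * (S - T)) *
        (|Y S t| + (M * Real.exp ((μ - l) * (t - S)) - M * Real.exp (μ * (t - S)))) := by
    refine intervalIntegral.integral_mono_on hTS ?_ ?_ fun t ht => ?_
    · exact hint.mul_continuousOn (by fun_prop)
    · exact (hint.add (hexp.intervalIntegrable _ _)).const_mul _
    · have e1 : Real.exp (-l * (t - T)) = Real.exp (-l * (S - T)) * Real.exp (l * (S - t)) := by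
        rw [← Real.exp_add]; congr 1; ring
      have e2 : Real.exp ((μ - l) * (t - S)) = Real.exp (-μ * (S - t)) * Real.exp (l * (S - t)) := by
        rw [← Real.exp_add]; congr 1; ring
      have e3 : Real.exp (μ * (t - S)) = Real.exp (-μ * (S - t)) := by congr 1; ring
      have h2 : 1 ≤ Real.exp (l * (S - t)) :=
        Real.one_le_exp (mul_nonneg hl (sub_nonneg.2 ht.2))
      have h3 := hY t S (by linarith [ht.1]) ht.2
      rw [e1, e2, e3, mul_left_comm]
      refine mul_le_mul_of_nonneg_left ?_ (Real.exp_pos _).le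
      nlinarith
  refine h1.trans ?_
  rw [intervalIntegral.integral_const_mul]
  refine mul_le_mul_of_nonneg_left ?_ (Real.exp_pos _).le
  rw [intervalIntegral.integral_add hint (hexp.intervalIntegrable _ _)]
  refine add_le_add (integral_abs_le_supIntegral hT hTS
    (supIntegral_ne_top ht₀ hM hμ hY) hc) ?_
  rw [intervalIntegral.integral_sub (by apply Continuous.intervalIntegrable; fun_prop)
      (by apply Continuous.intervalIntegrable; fun_prop),
    intervalIntegral.integral_const_mul, intervalIntegral.integral_const_mul,
    integral_exp_mul_sub hμl.ne', integral_exp_mul_sub hμ.ne', ← mul_sub]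
  refine mul_le_mul_of_nonneg_left ?_ hM.le
  simp only [sub_self, mul_zero, Real.exp_zero]
  have h4 : Real.exp (μ * (T - S)) / μ ≤ Real.exp ((μ - l) * (T - S)) / (μ - l) := by
    refine div_le_div₀ (Real.exp_pos _).le (Real.exp_le_exp.2 ?_) hμl (by linarith)
    nlinarith
  rw [sub_div, sub_div]
  linarith

section DelayEquation

variable {a b g h φ ψ x v : ℝ → ℝ} {s x₀ x₁ A B D : ℝ}

/-- Crude exponential growth estimate for solutions of the delay equation. -/
theorem IsDelaySolution.abs_le_exp_growth (hs : 0 ≤ s) (hA : 0 ≤ A) (hB : 0 ≤ B)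
    (ha : ∀ᵐ t, 0 ≤ t → |a t| ≤ A) (hb : ∀ᵐ t, 0 ≤ t → |b t| ≤ B)
    (hgt : ∀ t, 0 ≤ t → g t ≤ t) (hht : ∀ t, 0 ≤ t → h t ≤ t)
    (hx : IsDelaySolution a b g h s φ ψ x₀ x₁ x v)
    (hxD : ∀ t ≤ s, |x t| ≤ D) (hvD : ∀ t ≤ s, |v t| ≤ D) {S : ℝ} (hS : s ≤ S) :
    |x S| ≤ 3 * D * Real.exp ((2 * (A + B) + 2) * (S - s)) ∧
      |v S| ≤ 3 * D * Real.exp ((2 * (A + B) + 2) * (S - s)) := by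
  have hD : 0 ≤ D := (abs_nonneg _).trans (hxD s le_rfl)
  set κ := 2 * (A + B) + 2 with hκ
  have hκ0 : 0 < κ := by positivity
  have hf := hx.isForcedSolution
  set E : ℝ → ℝ := fun t => Real.exp (κ * (t - s)) with hE
  have hEpos : ∀ t, 0 < E t := fun t => Real.exp_pos _
  have hEc : Continuous E := by simp only [hE]; fun_prop
  have hE1 : ∀ t, s ≤ t → 1 ≤ E t := fun t ht =>
    Real.one_le_exp (mul_nonneg hκ0.le (sub_nonneg.2 ht))
  have hEmono : ∀ r t, r ≤ t → E r ≤ E t := fun r t hrt => by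
    simp only [hE]; gcongr
  have hcont : ContinuousOn (fun t => max |x t| |v t| / E t) (Icc s S) := by
    refine ContinuousOn.div ?_ hEc.continuousOn fun t _ => (hEpos t).ne'
    exact (hf.continuousOn.mono Icc_subset_Ici_self).abs.sup
      (hf.continuousOn_deriv.mono Icc_subset_Ici_self).abs
  obtain ⟨t', ht', hmax⟩ := isCompact_Icc.exists_isMaxOn ⟨s, le_rfl, hS⟩ hcont
  set Q := max |x t'| |v t'| / E t' with hQ
  have hQ0 : 0 ≤ Q := by positivity
  have hle : ∀ t ∈ Icc s S, max |x t| |v t| ≤ Q * E t := fun t ht => by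
    have := hmax ht
    simp only [mem_ofPred_eq] at this
    rwa [div_le_iff₀ (hEpos t)] at this
  have hpast : ∀ r t, s ≤ t → t ≤ S → r ≤ t → max |x r| |v r| ≤ (D + Q) * E t := by
    intro r t hst htS hrt
    have := hE1 t hst
    rcases le_total r s with hrs | hrs
    · exact (max_le (hxD r hrs) (hvD r hrs)).trans (by nlinarith)
    · have h1 := hle r ⟨hrs, hrt.trans htS⟩
      have h2 := hEmono r t hrt
      nlinarith
  have hst' : s ≤ t' := ht'.1
  have hint : IntervalIntegrable (fun t => κ / 2 * (D + Q) * E t) volume s t' :=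
    (hEc.const_mul _).intervalIntegrable _ _
  have hval : ∫ t in s..t', κ / 2 * (D + Q) * E t ≤ (D + Q) / 2 * E t' := by
    rw [intervalIntegral.integral_const_mul, hE, integral_exp_mul_sub hκ0.ne']
    have e : κ / 2 * (D + Q) * ((Real.exp (κ * (t' - s)) - Real.exp (κ * (s - s))) / κ) =
        (D + Q) / 2 * (Real.exp (κ * (t' - s)) - Real.exp (κ * (s - s))) := by
      field_simp
    rw [e]
    have := Real.exp_pos (κ * (s - s))
    gcongr
    linarith
  have hv : |v t' - v s| ≤ (D + Q) / 2 * E t' := by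
    refine ((hf.absolutelyContinuous t' hst').abs_sub_le_integral_of_abs_deriv_le hst' hint
      ?_).trans hval
    filter_upwards [hx.equation_ae, ha, hb] with t h1 h2 h3 ht
    have ht0 : 0 ≤ t := hs.trans ht.1
    have e : deriv v t = -(a t * v (g t)) - b t * x (h t) := by linarith [(h1 ht.1).2]
    have k1 := hpast (g t) t ht.1 (ht.2.trans ht'.2) (hgt t ht0)
    have k2 := hpast (h t) t ht.1 (ht.2.trans ht'.2) (hht t ht0)
    calc |deriv v t| ≤ |a t| * |v (g t)| + |b t| * |x (h t)| := by
          rw [e]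
          refine (abs_sub _ _).trans ?_
          rw [abs_neg, abs_mul, abs_mul]
      _ ≤ A * ((D + Q) * E t) + B * ((D + Q) * E t) := by
          gcongr
          · exact h2 ht0
          · exact (le_max_right _ _).trans k1
          · exact h3 ht0
          · exact (le_max_left _ _).trans k2
      _ ≤ κ / 2 * (D + Q) * E t := by
          have : 0 ≤ (D + Q) * E t := by have := hEpos t; positivity
          rw [hκ]; nlinarith
  have hx' : |x t' - x s| ≤ (D + Q) / 2 * E t' := by
    refine ((hf.absolutelyContinuousOnInterval hst').abs_sub_le_integral_of_abs_deriv_le hst' hint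
      ?_).trans hval
    filter_upwards [hf.ae_hasDerivAt] with t h1 ht
    rw [(h1 ht.1).1.deriv]
    refine ((le_max_right _ _).trans (hpast t t ht.1 (ht.2.trans ht'.2) le_rfl)).trans ?_
    have : 0 ≤ (D + Q) * E t := by have := hEpos t; positivity
    rw [hκ]; nlinarith
  have hEt' := hE1 t' hst'
  have hQle : Q ≤ 3 * D := by
    have e : Q * E t' = max |x t'| |v t'| := by rw [hQ, div_mul_cancel₀ _ (hEpos t').ne']
    have h1 : max |x t'| |v t'| ≤ (3 * D / 2 + Q / 2) * E t' := by
      have k1 := abs_sub_abs_le_abs_sub (x t') (x s)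
      have k2 := abs_sub_abs_le_abs_sub (v t') (v s)
      have k3 := hxD s le_rfl
      have k4 := hvD s le_rfl
      refine max_le ?_ ?_ <;> nlinarith
    rw [← e] at h1
    have := le_of_mul_le_mul_right h1 (hEpos t')
    linarith
  have hfin := hle S ⟨hS, le_rfl⟩
  have h2 : Q * E S ≤ 3 * D * E S := mul_le_mul_of_nonneg_right hQle (hEpos S).le
  exact ⟨(le_max_left _ _).trans (hfin.trans h2), (le_max_right _ _).trans (hfin.trans h2)⟩

/-- Weighted estimate of the derivative through the function, by comparison with the positive
solution `z` of the first order equation. -/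
theorem IsDelaySolution.abs_deriv_le_of_abs_le {z : ℝ → ℝ} {t₀ T S α β τ l X : ℝ}
    (hx : IsDelaySolution a b g h s φ ψ x₀ x₁ x v) (hsT : s ≤ T) (hT : t₀ ≤ T) (hTS : T ≤ S)
    (hz : AbsolutelyContinuousOnInterval z t₀ S) (hzpos : ∀ t ∈ Icc t₀ S, 0 < z t)
    (hz0 : ∀ t < t₀, z t = 0)
    (hzeq : ∀ᵐ t, t₀ ≤ t → DifferentiableAt ℝ z t ∧ deriv z t + a t * z (g t) = 0)
    (hα : 0 < α) (ha : ∀ᵐ t, t₀ ≤ t → α ≤ a t ∧ a t ≤ A)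
    (hβ : 0 ≤ β) (hb : ∀ᵐ t, T ≤ t → |b t| ≤ β * a t)
    (hgt : ∀ t, t₀ ≤ t → g t ≤ t) (hht : ∀ t, t₀ ≤ t → h t ≤ t)
    (hg : ∀ t, T ≤ t → t₀ ≤ g t) (hh : ∀ t, T ≤ t → t - h t ≤ τ)
    (hl : 0 ≤ l) (hlα : l < α) (hvD : ∀ r ≤ T, |v r| ≤ D)
    (hX : ∀ r ≤ S, |x r| ≤ X * Real.exp (-l * (r - T))) :
    |v S| ≤ (β * Real.exp (l * τ) * X + 2 * D) / (1 - l / α) * Real.exp (-l * (S - T)) := by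
  have hD : 0 ≤ D := (abs_nonneg _).trans (hvD T le_rfl)
  have hX0 : 0 ≤ X := by
    have := (abs_nonneg _).trans (hX S le_rfl)
    exact nonneg_of_mul_nonneg_left this (Real.exp_pos _)
  have hρ : 0 < 1 - l / α := by rw [sub_pos, div_lt_one hα]; exact hlα
  set K := (β * Real.exp (l * τ) * X + 2 * D) / (1 - l / α) with hK
  have hKeq : K * (1 - l / α) = β * Real.exp (l * τ) * X + 2 * D := by
    rw [hK, div_mul_cancel₀ _ hρ.ne']
  have hK0 : 0 ≤ K := by positivity
  have hKD : 2 * D ≤ K := by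
    have h1 : 0 ≤ β * Real.exp (l * τ) * X := by positivity
    have h2 : 0 ≤ K * (l / α) := by positivity
    nlinarith
  set w : ℝ → ℝ := fun t => Real.exp (-l * (t - T)) with hw
  have hwpos : ∀ t, 0 < w t := fun t => Real.exp_pos _
  have hwanti : ∀ r t, r ≤ t → w t ≤ w r := fun r t hrt => by
    simp only [hw]; apply Real.exp_le_exp.2; nlinarith
  have hwT : w T = 1 := by simp [hw]
  have hwd : ∀ t, HasDerivAt w (-l * w t) t := fun t => by
    have h1 : HasDerivAt (fun t => -l * (t - T)) (-l) t := by
      simpa using ((hasDerivAt_id t).sub_const T).const_mul (-l)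
    convert! h1.exp using 1
    ring
  have hwac : AbsolutelyContinuousOnInterval w T S :=
    ContDiffOn.absolutelyContinuousOnInterval (by simp only [hw]; fun_prop)
  have hf := hx.isForcedSolution.mono hsT
  have key : ∀ ε : ℝ, |ε| = 1 → 0 ≤ K * w S - ε * v S := by
    intro ε hε
    have hεle : ∀ c, |ε * c| = |c| := fun c => by rw [abs_mul, hε, one_mul]
    refine nonneg_of_neg_deriv_le_delay (y := fun t => K * w t - ε * v t) hT hTS hz hzpos hz0 hzeq
      (A := A) ?_ hgt hg ?_ ?_ ?_
    · filter_upwards [ha] with t ht htt using ⟨hα.le.trans (ht htt).1, (ht htt).2⟩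
    · exact (hwac.const_mul K).fun_sub ((hf.absolutelyContinuous S hTS).const_mul ε)
    · have h1 := (le_abs_self _).trans ((hεle (v T)).le.trans (hvD T le_rfl))
      rw [hwT]; linarith
    · filter_upwards [hx.equation_ae, ha, hb] with t h1 h2 h3 ht
      obtain ⟨hvd, heq⟩ := h1 (hsT.trans ht.1)
      have ht0 := hT.trans ht.1
      obtain ⟨hat, -⟩ := h2 ht0
      have hapos : 0 < a t := hα.trans_le hat
      have hbt := h3 ht.1
      rw [(((hwd t).const_mul K).fun_sub (hvd.hasDerivAt.const_mul ε)).deriv]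
      have hxh : |x (h t)| ≤ Real.exp (l * τ) * X * w t := by
        refine (hX _ ((hht t ht0).trans ht.2)).trans ?_
        have : Real.exp (-l * (h t - T)) ≤ Real.exp (l * τ) * w t := by
          simp only [hw]
          rw [← Real.exp_add]
          apply Real.exp_le_exp.2
          nlinarith [hh t ht.1]
        calc X * Real.exp (-l * (h t - T)) ≤ X * (Real.exp (l * τ) * w t) := by gcongr
          _ = _ := by ring
      have hbx : -(ε * (b t * x (h t))) ≤ a t * (β * Real.exp (l * τ) * X * w t) := by
        refine (neg_le_abs _).trans ?_
        rw [hεle, abs_mul]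
        calc |b t| * |x (h t)| ≤ (β * a t) * (Real.exp (l * τ) * X * w t) := by gcongr
          _ = _ := by ring
      have hlw : l * K * w t ≤ a t * (K * (l / α) * w t) := by
        have h4 : l ≤ a t * (l / α) := by
          rw [mul_div_assoc', le_div_iff₀ hα]; nlinarith
        have h5 : 0 ≤ K * w t := mul_nonneg hK0 (hwpos t).le
        nlinarith
      have hev : ε * deriv v t = -(a t * (ε * v (g t))) - ε * (b t * x (h t)) := by
        linear_combination ε * heq
      have main : l * K * w t + -(ε * (b t * x (h t))) ≤ a t * ((K - 2 * D) * w t) := by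
        have e : (K - 2 * D) * w t =
            K * (l / α) * w t + β * Real.exp (l * τ) * X * w t := by
          linear_combination w t * hKeq
        rw [e, mul_add]
        linarith
      have hgoal : ∀ y, (K - 2 * D) * w t - ε * v (g t) ≤ y →
          -(K * (-l * w t) - ε * deriv v t) ≤ a t * y := by
        intro y hy
        have := mul_le_mul_of_nonneg_left hy hapos.le
        rw [mul_sub] at this
        linarith
      apply hgoal
      split_ifs with hc
      · have h5 := hwanti (g t) t (hgt t ht0)
        have := mul_le_mul_of_nonneg_left h5 hK0
        have := mul_nonneg hD (hwpos t).le
        linarith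
      · push Not at hc
        have h5 := (neg_le_abs _).trans ((hεle (v (g t))).le.trans (hvD (g t) hc.le))
        have h6 := (le_abs_self _).trans ((hεle (v T)).le.trans (hvD T le_rfl))
        have h7 : (K - 2 * D) * w t ≤ K - 2 * D := by
          have := hwanti T t ht.1
          rw [hwT] at this
          nlinarith
        rw [hwT]
        linarith
  rw [abs_le']
  constructor
  · have := key 1 (by simp); linarith
  · have := key (-1) (by simp); linarith

end DelayEquation

/-- Weighted estimate of the delay equation regarded as a perturbation of the equation without
delays. -/
theorem IsDelaySolution.abs_perturbation_le {a b g h φ ψ x v : ℝ → ℝ}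
    {s x₀ x₁ A B T S δ τ l X K : ℝ} (hx : IsDelaySolution a b g h s φ ψ x₀ x₁ x v)
    (hsT : s ≤ T) (hδ0 : 0 ≤ δ) (hτ0 : 0 ≤ τ) (hA : 0 ≤ A) (hB : 0 ≤ B) (hl : 0 ≤ l)
    (ha : ∀ᵐ t, T ≤ t → |a t| ≤ A) (hb : ∀ᵐ t, T ≤ t → |b t| ≤ B)
    (hgt : ∀ t, T ≤ t → g t ≤ t) (hht : ∀ t, T ≤ t → h t ≤ t)
    (hg : ∀ t, T ≤ t → t - g t ≤ δ) (hh : ∀ t, T ≤ t → t - h t ≤ τ)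
    (hX : ∀ r ≤ S, |x r| ≤ X * Real.exp (-l * (r - T)))
    (hK : ∀ r ≤ S, |v r| ≤ K * Real.exp (-l * (r - T))) :
    ∀ᵐ t, t ∈ Icc (T + δ + τ) S → |a t * (v t - v (g t)) + b t * (x t - x (h t))| ≤
      Real.exp (2 * l * (δ + τ)) * (A * δ * (A * K + B * X) + B * τ * K) *
        Real.exp (-l * (t - T)) := by
  have hX0 : 0 ≤ X :=
    nonneg_of_mul_nonneg_left ((abs_nonneg _).trans (hX S le_rfl)) (Real.exp_pos _)
  have hK0 : 0 ≤ K :=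
    nonneg_of_mul_nonneg_left ((abs_nonneg _).trans (hK S le_rfl)) (Real.exp_pos _)
  filter_upwards [ha, hb] with t hat hbt ht
  have hTt : T ≤ t := by linarith [ht.1]
  have hf := hx.isForcedSolution.mono hsT
  set m := Real.exp (2 * l * (δ + τ)) * Real.exp (-l * (t - T)) with hm
  have hm0 : 0 < m := by positivity
  have hw : ∀ r, t - 2 * (δ + τ) ≤ r → Real.exp (-l * (r - T)) ≤ m := by
    intro r hr
    rw [hm, ← Real.exp_add]
    apply Real.exp_le_exp.2
    nlinarith
  have hg1 := hg t hTt
  have hh1 := hh t hTt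
  have hTg : T ≤ g t := by linarith [ht.1]
  have hTh : T ≤ h t := by linarith [ht.1]
  have hgt' := hgt t hTt
  have hht' := hht t hTt
  have hv : |v t - v (g t)| ≤ δ * ((A * K + B * X) * m) := by
    have hac : AbsolutelyContinuousOnInterval v (g t) t :=
      (hf.mono hTg).absolutelyContinuous t hgt'
    refine (hac.abs_sub_le_integral_of_abs_deriv_le hgt' (F := fun _ => (A * K + B * X) * m)
      (by simp) ?_).trans ?_
    · filter_upwards [hx.equation_ae, ha, hb] with r h1 h2 h3 hr
      have hTr : T ≤ r := hTg.trans hr.1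
      have e : deriv v r = -(a r * v (g r)) - b r * x (h r) := by
        linarith [(h1 (hsT.trans hTr)).2]
      have k1 : |v (g r)| ≤ K * m := by
        refine (hK _ ((hgt r hTr).trans (hr.2.trans ht.2))).trans ?_
        gcongr
        exact hw _ (by linarith [hg r hTr, hr.1])
      have k2 : |x (h r)| ≤ X * m := by
        refine (hX _ ((hht r hTr).trans (hr.2.trans ht.2))).trans ?_
        gcongr
        exact hw _ (by linarith [hh r hTr, hr.1])
      calc |deriv v r| ≤ |a r| * |v (g r)| + |b r| * |x (h r)| := by
            rw [e]
            refine (abs_sub _ _).trans ?_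
            rw [abs_neg, abs_mul, abs_mul]
        _ ≤ A * (K * m) + B * (X * m) := by
            gcongr
            · exact h2 hTr
            · exact h3 hTr
        _ = (A * K + B * X) * m := by ring
    · rw [intervalIntegral.integral_const, smul_eq_mul]
      gcongr
  have hxh : |x t - x (h t)| ≤ τ * (K * m) := by
    have hac : AbsolutelyContinuousOnInterval x (h t) t :=
      (hf.mono hTh).absolutelyContinuousOnInterval hht'
    refine (hac.abs_sub_le_integral_of_abs_deriv_le hht' (F := fun _ => K * m)
      (by simp) ?_).trans ?_
    · filter_upwards [hf.ae_hasDerivAt] with r h1 hr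
      rw [(h1 (hTh.trans hr.1)).1.deriv]
      refine (hK r (hr.2.trans ht.2)).trans ?_
      gcongr
      exact hw _ (by linarith [hr.1])
    · rw [intervalIntegral.integral_const, smul_eq_mul]
      gcongr
  calc |a t * (v t - v (g t)) + b t * (x t - x (h t))|
      ≤ |a t| * |v t - v (g t)| + |b t| * |x t - x (h t)| := by
        refine (abs_add_le _ _).trans ?_
        rw [abs_mul, abs_mul]
    _ ≤ A * (δ * ((A * K + B * X) * m)) + B * (τ * (K * m)) := by
        gcongr
        · exact hat hTt
        · exact hbt hTt
    _ = _ := by rw [hm]; ring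

set_option maxHeartbeats 600000 in
/-- Exponential decay of a solution of the delay equation, with explicit constants, when the
weighted perturbation bound `θ` is less than one. -/
theorem IsDelaySolution.abs_le_exp_decay {a b g h φ ψ x v z : ℝ → ℝ} {Y : ℝ → ℝ → ℝ}
    {s x₀ x₁ A₀ A B T S t₀ α β δ τ l M μ D θ y c : ℝ}
    (hx : IsDelaySolution a b g h s φ ψ x₀ x₁ x v)
    (hsT : s ≤ T) (ht₀ : 0 ≤ t₀) (hT : t₀ + δ ≤ T) (hTS : T ≤ S)
    (hδ0 : 0 ≤ δ) (hτ0 : 0 ≤ τ) (hA : 0 ≤ A) (hB : 0 ≤ B) (hα : 0 < α) (hβ : 0 ≤ β)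
    (ha₀ : ∀ᵐ t, 0 ≤ t → |a t| ≤ A₀) (haα : ∀ᵐ t, t₀ ≤ t → α ≤ a t)
    (ha : ∀ᵐ t, T ≤ t → |a t| ≤ A) (hb : ∀ᵐ t, T ≤ t → |b t| ≤ B)
    (hba : ∀ᵐ t, T ≤ t → |b t| ≤ β * a t)
    (hgt : ∀ t, 0 ≤ t → g t ≤ t) (hht : ∀ t, 0 ≤ t → h t ≤ t)
    (hg : ∀ t, t₀ ≤ t → t - g t ≤ δ) (hh : ∀ t, t₀ ≤ t → t - h t ≤ τ)
    (hz : ∀ S, t₀ ≤ S → AbsolutelyContinuousOnInterval z t₀ S) (hzpos : ∀ t, t₀ ≤ t → 0 < z t)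
    (hz0 : ∀ t < t₀, z t = 0)
    (hzeq : ∀ᵐ t, t₀ ≤ t → DifferentiableAt ℝ z t ∧ deriv z t + a t * z (g t) = 0)
    (hY : IsFundamentalFunction a b (fun t => t) (fun t => t) Y) (hM0 : 0 < M)
    (hM : ∀ t₀ : ℝ, 0 ≤ t₀ → ∀ (x₀ x₁ : ℝ) (x v : ℝ → ℝ),
      IsDelaySolution a b (fun t => t) (fun t => t) t₀ (fun _ => 0) (fun _ => 0) x₀ x₁ x v →
        ∀ t, t₀ ≤ t → |x t| ≤ M * Real.exp (-μ * (t - t₀)) * (|x₀| + |x₁|))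
    (hl : 0 ≤ l) (hlα : l < α) (hlμ : l < μ)
    (hxD : ∀ r ≤ T + δ + τ + 1, |x r| ≤ D) (hvD : ∀ r ≤ T + δ + τ + 1, |v r| ≤ D)
    (hy : y = (supIntegral t₀ Y).toReal + M * (1 / (μ - l) - 1 / μ))
    (hθ : θ = y * (Real.exp (2 * l * (δ + τ)) *
      ((A ^ 2 * δ + B * τ) * (β * Real.exp (l * τ) / (1 - l / α)) + A * B * δ)))
    (hc : c = y * (Real.exp (2 * l * (δ + τ)) * ((A ^ 2 * δ + B * τ) * (2 / (1 - l / α)))))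
    (hθ1 : θ < 1) :
    |x S| ≤ (1 + c + (2 * M + 1) * Real.exp (l * (δ + τ + 1))) / (1 - θ) * D *
      Real.exp (-l * (S - T)) := by
  have hμ : 0 < μ := hl.trans_lt hlμ
  have hρ : 0 < 1 - l / α := by rw [sub_pos, div_lt_one hα]; exact hlα
  have hT0 : t₀ ≤ T := by linarith
  have hD : 0 ≤ D := (abs_nonneg _).trans (hxD T (by linarith))
  have hf := hx.isForcedSolution.mono hsT
  set w : ℝ → ℝ := fun t => Real.exp (-l * (t - T)) with hw
  have hwpos : ∀ t, 0 < w t := fun t => Real.exp_pos _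
  have hwc : Continuous w := by simp only [hw]; fun_prop
  have hwpast : ∀ r ≤ T, 1 ≤ w r := fun r hr =>
    Real.one_le_exp (mul_nonneg_of_nonpos_of_nonpos (neg_nonpos.2 hl) (sub_nonpos.2 hr))
  have hcont : ContinuousOn (fun t => |x t| / w t) (Icc T S) :=
    (hf.continuousOn.mono Icc_subset_Ici_self).abs.div hwc.continuousOn
      fun t _ => (hwpos t).ne'
  obtain ⟨t', ht', hmax⟩ := isCompact_Icc.exists_isMaxOn ⟨T, le_rfl, hTS⟩ hcont
  set X₁ := |x t'| / w t' with hX₁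
  have hX₁0 : 0 ≤ X₁ := by positivity
  have hle : ∀ t ∈ Icc T S, |x t| ≤ X₁ * w t := fun t ht => by
    have := hmax ht
    simp only [mem_ofPred_eq] at this
    rwa [div_le_iff₀ (hwpos t)] at this
  set X := X₁ + D with hXdef
  have hX : ∀ r ≤ S, |x r| ≤ X * w r := by
    intro r hr
    have h1 := hwpos r
    rcases le_total r T with h2 | h2
    · exact (hxD r (by linarith)).trans ((le_add_of_nonneg_left hX₁0).trans
        (le_mul_of_one_le_right (by positivity) (hwpast r h2)))
    · exact (hle r ⟨h2, hr⟩).trans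
        (mul_le_mul_of_nonneg_right (le_add_of_nonneg_right hD) h1.le)
  set K := (β * Real.exp (l * τ) * X + 2 * D) / (1 - l / α) with hKdef
  have hX0 : 0 ≤ X := by positivity
  have hDK : D ≤ K := by
    rw [hKdef, le_div_iff₀ hρ]
    have h1 : 0 ≤ β * Real.exp (l * τ) * X := by positivity
    have h2 : 0 ≤ l / α := by positivity
    nlinarith
  have hK : ∀ r ≤ S, |v r| ≤ K * w r := by
    intro r hr
    rcases le_total r T with h2 | h2
    · exact ((hvD r (by linarith)).trans hDK).trans
        (le_mul_of_one_le_right (hD.trans hDK) (hwpast r h2))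
    · refine hx.abs_deriv_le_of_abs_le (A := A₀) hsT hT0 h2 (hz r (hT0.trans h2))
        (fun t ht => hzpos t ht.1) hz0 hzeq hα ?_ hβ hba (fun t ht => hgt t (ht₀.trans ht))
        (fun t ht => hht t (ht₀.trans ht)) (fun t ht => ?_) (fun t ht => hh t (hT0.trans ht)) hl hlα
        (fun t ht => hvD t (by linarith)) fun t ht => hX t (ht.trans hr)
      · filter_upwards [ha₀, haα] with t h3 h4 h5
        exact ⟨h4 h5, (le_abs_self _).trans (h3 (ht₀.trans h5))⟩
      · have := hg t (hT0.trans ht)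
        linarith
  have hpert := hx.abs_perturbation_le hsT hδ0 hτ0 hA hB hl ha hb
    (fun t ht => hgt t (ht₀.trans (hT0.trans ht))) (fun t ht => hht t (ht₀.trans (hT0.trans ht)))
    (fun t ht => hg t (hT0.trans ht)) (fun t ht => hh t (hT0.trans ht)) hX hK
  set G := Real.exp (2 * l * (δ + τ)) * (A * δ * (A * K + B * X) + B * τ * K) with hG
  have hK0 : 0 ≤ K := hD.trans hDK
  have hG0 : 0 ≤ G := by positivity
  have hYexp : ∀ σ t, 0 ≤ σ → σ ≤ t → |Y t σ| ≤ M * Real.exp (-μ * (t - σ)) := by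
    intro σ t hσ hσt
    obtain ⟨u, hu⟩ := hY σ hσ
    simpa using hM σ hσ 0 1 _ u hu t hσt
  have hy0 : 0 ≤ y := by
    rw [hy]
    have : 1 / μ ≤ 1 / (μ - l) := one_div_le_one_div_of_le (sub_pos.2 hlμ) (by linarith)
    have := mul_nonneg hM0.le (sub_nonneg.2 this)
    positivity
  have hyG : y * G = θ * X + c * D := by
    rw [hθ, hc, hG, hKdef]
    field_simp
    ring
  have hc0 : 0 ≤ c := by rw [hc]; positivity
  set Λ := Real.exp (l * (δ + τ + 1)) with hΛ
  have hΛ0 : 0 < Λ := Real.exp_pos _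
  have hbound : |x t'| ≤ (θ * X + c * D + (2 * M + 1) * Λ * D) * w t' := by
    have hθ0 : 0 ≤ θ * X + c * D := hyG ▸ mul_nonneg hy0 hG0
    have hwt' := hwpos t'
    rcases le_total t' (T + δ + τ + 1) with h1 | h1
    · have h2 : 1 ≤ Λ * w t' := by
        rw [hΛ, hw, ← Real.exp_add]
        have := mul_nonneg hl (sub_nonneg.2 h1)
        exact Real.one_le_exp (by linarith)
      calc |x t'| ≤ D * 1 := by rw [mul_one]; exact hxD t' h1
        _ ≤ D * (Λ * w t') := by gcongr
        _ = (0 + (2 * 0 + 1) * Λ * D) * w t' := by ring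
        _ ≤ _ := by gcongr
    · have hsT₂ : s ≤ T + δ + τ + 1 := by linarith
      obtain ⟨hYc, h2⟩ := abs_le_of_isForcedSolution ha₀ hY hM (by linarith) h1
        (hx.isForcedSolution.mono hsT₂) (F := fun t => G * w t) (hwc.const_mul G) (by
          filter_upwards [hpert] with t h3 h4
          exact h3 ⟨by linarith [h4.1], h4.2.trans ht'.2⟩)
      have h3 := integral_abs_mul_exp_le (M := M) (μ := μ) (l := l) ht₀ (by linarith) h1 hM0 hl hlμ
        hYexp hYc
      rw [← hy] at h3
      have e4 : ∫ t in (T + δ + τ + 1)..t', |Y t' t| * (G * w t) =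
          G * w (T + δ + τ + 1) *
            ∫ t in (T + δ + τ + 1)..t', |Y t' t| * Real.exp (-l * (t - (T + δ + τ + 1))) := by
        rw [← intervalIntegral.integral_const_mul]
        refine intervalIntegral.integral_congr fun t _ => ?_
        have : w t = w (T + δ + τ + 1) * Real.exp (-l * (t - (T + δ + τ + 1))) := by
          simp only [hw]
          rw [← Real.exp_add]; congr 1; ring
        simp only [this]
        ring
      have e5 : w (T + δ + τ + 1) * Real.exp (-l * (t' - (T + δ + τ + 1))) = w t' := by
        simp only [hw]
        rw [← Real.exp_add]; congr 1; ring
      have h6 : ∫ t in (T + δ + τ + 1)..t', |Y t' t| * (G * w t) ≤ (θ * X + c * D) * w t' := by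
        rw [e4]
        calc _ ≤ G * w (T + δ + τ + 1) *
              (Real.exp (-l * (t' - (T + δ + τ + 1))) * y) := by
              have := hwpos (T + δ + τ + 1)
              gcongr
          _ = y * G * w t' := by rw [← e5]; ring
          _ = _ := by rw [hyG]
      have h7 : Real.exp (-μ * (t' - (T + δ + τ + 1))) ≤ Λ * w t' := by
        rw [hΛ, hw, ← Real.exp_add]
        have := mul_nonneg (sub_nonneg.2 hlμ.le) (sub_nonneg.2 h1)
        exact Real.exp_le_exp.2 (by linarith)
      have h8 : M * Real.exp (-μ * (t' - (T + δ + τ + 1))) *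
          (|x (T + δ + τ + 1)| + |v (T + δ + τ + 1)|) ≤ M * (Λ * w t') * (D + D) := by
        gcongr
        · exact hxD _ le_rfl
        · exact hvD _ le_rfl
      have h9 : 0 ≤ Λ * D * w t' := by positivity
      linarith
  have hX₁le : X₁ ≤ θ * X + c * D + (2 * M + 1) * Λ * D := by
    rw [hX₁, div_le_iff₀ (hwpos t')]
    exact hbound
  have hX₁fin : X₁ ≤ (1 + c + (2 * M + 1) * Λ) / (1 - θ) * D := by
    rw [div_mul_eq_mul_div, le_div_iff₀ (sub_pos.2 hθ1)]
    have : θ * D ≤ D := mul_le_of_le_one_left hD hθ1.le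
    rw [hXdef] at hX₁le
    linarith
  refine (hle S ⟨hTS, le_rfl⟩).trans ?_
  exact mul_le_mul_of_nonneg_right hX₁fin (hwpos S).le

theorem ae_abs_le_toReal_linftyNorm {f : ℝ → ℝ} {t₁ : ℝ} (hf : linftyNorm t₁ f ≠ ⊤) :
    ∀ᵐ t, t₁ ≤ t → |f t| ≤ (linftyNorm t₁ f).toReal := by
  have h := ae_le_eLpNormEssSup (f := f) (μ := volume.restrict (Ici t₁))
  have h' := (ae_restrict_iff' measurableSet_Ici).1 h
  filter_upwards [h'] with t ht htt
  have h1 : ‖f t‖ₑ ≤ linftyNorm t₁ f := by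
    rw [linftyNorm, eLpNorm_exponent_top]; exact ht htt
  have h2 := ENNReal.toReal_mono hf h1
  rwa [toReal_enorm, Real.norm_eq_abs] at h2

theorem linftyNorm_anti {f : ℝ → ℝ} {s t : ℝ} (hst : s ≤ t) : linftyNorm t f ≤ linftyNorm s f :=
  eLpNorm_mono_measure f (Measure.restrict_mono (Ici_subset_Ici.2 hst) le_rfl)

theorem linftyNorm_div_ne_top {a b : ℝ → ℝ} {t₁ α B : ℝ} (hα : 0 < α)
    (ha : ∀ᵐ t, t₁ ≤ t → α ≤ a t) (hb : ∀ᵐ t, t₁ ≤ t → |b t| ≤ B) :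
    linftyNorm t₁ (fun t => b t / a t) ≠ ⊤ := by
  rw [linftyNorm, eLpNorm_exponent_top]
  refine ne_top_of_le_ne_top ENNReal.ofReal_ne_top
    (eLpNormEssSup_le_of_ae_bound (C := B / α) ?_)
  rw [ae_restrict_iff' measurableSet_Ici]
  filter_upwards [ha, hb] with t h1 h2 ht
  have h3 := h1 ht
  rw [Real.norm_eq_abs, abs_div, abs_of_pos (hα.trans_le h3)]
  exact div_le_div₀ ((abs_nonneg _).trans (h2 ht)) (h2 ht) hα h3

/-- If the perturbation bound is less than one, it remains so under a small exponential weight. -/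
theorem exists_weight_lt_one {Ys M μ α A B β δ τ : ℝ} (hα : 0 < α) (hμ : 0 < μ)
    (h : Ys * (δ * A * (A * β + B) + τ * B * β) < 1) :
    ∃ l, 0 < l ∧ l < α ∧ l < μ ∧ (Ys + M * (1 / (μ - l) - 1 / μ)) *
      (Real.exp (2 * l * (δ + τ)) *
        ((A ^ 2 * δ + B * τ) * (β * Real.exp (l * τ) / (1 - l / α)) + A * B * δ)) < 1 := by
  set Θ : ℝ → ℝ := fun l => (Ys + M * (1 / (μ - l) - 1 / μ)) *
      (Real.exp (2 * l * (δ + τ)) *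
        ((A ^ 2 * δ + B * τ) * (β * Real.exp (l * τ) / (1 - l / α)) + A * B * δ)) with hΘ
  have hc : ContinuousAt Θ 0 := by
    have h1 : ContinuousAt (fun l : ℝ => 1 / (μ - l)) 0 :=
      ContinuousAt.div (by fun_prop) (by fun_prop) (by simpa using hμ.ne')
    have h2 : ContinuousAt (fun l : ℝ => β * Real.exp (l * τ) / (1 - l / α)) 0 :=
      ContinuousAt.div (by fun_prop) (by fun_prop) (by simp)
    simp only [hΘ]
    fun_prop
  have h0 : Θ 0 < 1 := by
    refine lt_of_eq_of_lt ?_ h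
    simp [hΘ]
    ring_nf
    simp
  have hev : ∀ᶠ l in nhdsWithin 0 (Ioi 0), Θ l < 1 :=
    (hc.eventually_lt continuousAt_const h0).filter_mono nhdsWithin_le_nhds
  have hmem : Ioo 0 (min α μ) ∈ nhdsWithin (0 : ℝ) (Ioi 0) :=
    Ioo_mem_nhdsGT (lt_min hα hμ)
  obtain ⟨l, h1, h2⟩ := (hev.and hmem).exists
  exact ⟨l, h2.1, h2.2.trans_le (min_le_left _ _), h2.2.trans_le (min_le_right _ _), h1⟩

/-- The prehistory and the initial values are bounded by the norm of the initial data. -/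
theorem IsDelaySolution.abs_le_initial_data {a b g h φ ψ x v : ℝ → ℝ} {s x₀ x₁ : ℝ}
    (hx : IsDelaySolution a b g h s φ ψ x₀ x₁ x v)
    (hφ : BddAbove ((fun t => |φ t|) '' Iio s)) (hψ : BddAbove ((fun t => |ψ t|) '' Iio s)) :
    ∀ r ≤ s, |x r| ≤ |x₀| + |x₁| + ⨆ r : Iio s, (|φ r| + |ψ r|) ∧
      |v r| ≤ |x₀| + |x₁| + ⨆ r : Iio s, (|φ r| + |ψ r|) := by
  have hbdd : BddAbove (range fun r : Iio s => |φ r| + |ψ r|) := by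
    obtain ⟨c₁, h₁⟩ := hφ
    obtain ⟨c₂, h₂⟩ := hψ
    refine ⟨c₁ + c₂, ?_⟩
    rintro _ ⟨r, rfl⟩
    exact add_le_add (h₁ ⟨r, r.2, rfl⟩) (h₂ ⟨r, r.2, rfl⟩)
  have hsup0 : 0 ≤ ⨆ r : Iio s, (|φ r| + |ψ r|) := Real.iSup_nonneg fun r => by positivity
  intro r hr
  have := abs_nonneg x₀
  have := abs_nonneg x₁
  rcases hr.lt_or_eq with h1 | rfl
  · have h2 := le_ciSup hbdd ⟨r, h1⟩
    simp only at h2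
    have := abs_nonneg (φ r)
    have := abs_nonneg (ψ r)
    rw [hx.prehistory r h1, hx.prehistory_deriv r h1]
    constructor <;> linarith
  · rw [hx.initial, hx.initial_deriv]
    constructor <;> linarith

theorem theorem2 (a b g h : ℝ → ℝ)
    (ha : MemLp a ∞ (volume.restrict (Ici 0))) (hb : MemLp b ∞ (volume.restrict (Ici 0)))
    (hg : AEMeasurable g (volume.restrict (Ici 0)))
    (hh : AEMeasurable h (volume.restrict (Ici 0)))
    (hgt : ∀ t, 0 ≤ t → g t ≤ t) (hht : ∀ t, 0 ≤ t → h t ≤ t)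
    (hODE : IsExponentiallyStable a b (fun t => t) (fun t => t))
    (t₀ : ℝ) (ht₀ : 0 ≤ t₀)
    (hZ : ∃ Z : ℝ → ℝ → ℝ, IsFirstOrderFundamentalFunction a g Z ∧
      ∀ s t, t₀ ≤ s → s ≤ t → 0 < Z t s)
    (α : ℝ) (hα : 0 < α) (haα : ∀ᵐ t ∂(volume.restrict (Ici t₀)), α ≤ a t)
    (δ τ : ℝ) (hδ : ∀ t, t₀ ≤ t → t - g t ≤ δ) (hτ : ∀ t, t₀ ≤ t → t - h t ≤ τ)
    (Y : ℝ → ℝ → ℝ) (hY : IsFundamentalFunction a b (fun t => t) (fun t => t) Y)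
    (t₁ : ℝ) (ht₁ : t₀ + δ ≤ t₁)
    (hineq : supIntegral t₀ Y *
      (ENNReal.ofReal δ * linftyNorm t₁ a *
          (linftyNorm t₁ a * linftyNorm t₁ (fun t => b t / a t) + linftyNorm t₁ b) +
        ENNReal.ofReal τ * linftyNorm t₁ b * linftyNorm t₁ (fun t => b t / a t)) < 1) :
    IsExponentiallyStable a b g h := by
  simp only [ae_restrict_iff' measurableSet_Ici, mem_Ici] at haα
  obtain ⟨Z, hZ, hZpos⟩ := hZ
  obtain ⟨M, hM0, μ, hμ, hstab⟩ := hODE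
  have hM : ∀ t₀ : ℝ, 0 ≤ t₀ → ∀ (x₀ x₁ : ℝ) (x v : ℝ → ℝ),
      IsDelaySolution a b (fun t => t) (fun t => t) t₀ (fun _ => 0) (fun _ => 0) x₀ x₁ x v →
        ∀ t, t₀ ≤ t → |x t| ≤ M * Real.exp (-μ * (t - t₀)) * (|x₀| + |x₁|) := by
    intro s hs x₀ x₁ x v hx t ht
    have := hstab s hs _ _ measurable_const measurable_const
      ⟨0, by rintro _ ⟨r, -, rfl⟩; simp⟩ ⟨0, by rintro _ ⟨r, -, rfl⟩; simp⟩ x₀ x₁ x v hx t ht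
    simpa using this
  have hδ0 : 0 ≤ δ := (sub_nonneg.2 (hgt t₀ ht₀)).trans (hδ t₀ le_rfl)
  have hτ0 : 0 ≤ τ := (sub_nonneg.2 (hht t₀ ht₀)).trans (hτ t₀ le_rfl)
  have ht₀₁ : t₀ ≤ t₁ := by linarith
  have ht₁0 : 0 ≤ t₁ := ht₀.trans ht₀₁
  have ha0 : linftyNorm 0 a ≠ ⊤ := ha.eLpNorm_ne_top
  have hb0 : linftyNorm 0 b ≠ ⊤ := hb.eLpNorm_ne_top
  have ha1 : linftyNorm t₁ a ≠ ⊤ := ne_top_of_le_ne_top ha0 (linftyNorm_anti ht₁0)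
  have hb1 : linftyNorm t₁ b ≠ ⊤ := ne_top_of_le_ne_top hb0 (linftyNorm_anti ht₁0)
  have hbB := ae_abs_le_toReal_linftyNorm hb1
  have hba1 : linftyNorm t₁ (fun t => b t / a t) ≠ ⊤ := by
    refine linftyNorm_div_ne_top hα ?_ hbB
    filter_upwards [haα] with t h1 h2 using h1 (ht₀₁.trans h2)
  have hYexp : ∀ σ t, 0 ≤ σ → σ ≤ t → |Y t σ| ≤ M * Real.exp (-μ * (t - σ)) := by
    intro σ t hσ hσt
    obtain ⟨u, hu⟩ := hY σ hσ
    simpa using hM σ hσ 0 1 _ u hu t hσt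
  have hYfin : supIntegral t₀ Y ≠ ⊤ := supIntegral_ne_top ht₀ hM0 hμ hYexp
  have haA := ae_abs_le_toReal_linftyNorm ha1
  have haA₀ := ae_abs_le_toReal_linftyNorm ha0
  have hbB₀ := ae_abs_le_toReal_linftyNorm hb0
  have hbaβ := ae_abs_le_toReal_linftyNorm hba1
  have hlt : (supIntegral t₀ Y).toReal * (δ * (linftyNorm t₁ a).toReal *
      ((linftyNorm t₁ a).toReal * (linftyNorm t₁ (fun t => b t / a t)).toReal +
        (linftyNorm t₁ b).toReal) + τ * (linftyNorm t₁ b).toReal *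
      (linftyNorm t₁ (fun t => b t / a t)).toReal) < 1 := by
    have h1 := ENNReal.toReal_strict_mono ENNReal.one_ne_top hineq
    rw [ENNReal.toReal_mul, ENNReal.toReal_add (by finiteness) (by finiteness),
      ENNReal.toReal_mul, ENNReal.toReal_mul, ENNReal.toReal_mul, ENNReal.toReal_mul,
      ENNReal.toReal_add (by finiteness) (by finiteness), ENNReal.toReal_mul,
      ENNReal.toReal_ofReal hδ0, ENNReal.toReal_ofReal hτ0, ENNReal.toReal_one] at h1
    exact h1
  generalize hA : (linftyNorm t₁ a).toReal = A at *
  generalize hB : (linftyNorm t₁ b).toReal = B at *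
  generalize hβ : (linftyNorm t₁ (fun t => b t / a t)).toReal = β at *
  generalize hA₀ : (linftyNorm 0 a).toReal = A₀ at *
  generalize hB₀ : (linftyNorm 0 b).toReal = B₀ at *
  have hA0 : 0 ≤ A := hA ▸ ENNReal.toReal_nonneg
  have hB0 : 0 ≤ B := hB ▸ ENNReal.toReal_nonneg
  have hβ0 : 0 ≤ β := hβ ▸ ENNReal.toReal_nonneg
  have hA₀0 : 0 ≤ A₀ := hA₀ ▸ ENNReal.toReal_nonneg
  have hB₀0 : 0 ≤ B₀ := hB₀ ▸ ENNReal.toReal_nonneg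
  have hba : ∀ᵐ t, t₁ ≤ t → |b t| ≤ β * a t := by
    filter_upwards [hbaβ, haα] with t h1 h2 ht
    have hapos : 0 < a t := hα.trans_le (h2 (ht₀₁.trans ht))
    have h3 := h1 ht
    rwa [abs_div, abs_of_pos hapos, div_le_iff₀ hapos] at h3
  obtain ⟨l, hl, hlα, hlμ, hθ1⟩ := exists_weight_lt_one (M := M) hα hμ hlt
  obtain ⟨y, hy⟩ : ∃ y, y = (supIntegral t₀ Y).toReal + M * (1 / (μ - l) - 1 / μ) := ⟨_, rfl⟩
  rw [← hy] at hθ1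
  obtain ⟨θ, hθ⟩ : ∃ θ, θ = y * (Real.exp (2 * l * (δ + τ)) *
      ((A ^ 2 * δ + B * τ) * (β * Real.exp (l * τ) / (1 - l / α)) + A * B * δ)) := ⟨_, rfl⟩
  rw [← hθ] at hθ1
  obtain ⟨c, hc⟩ : ∃ c, c = y * (Real.exp (2 * l * (δ + τ)) *
      ((A ^ 2 * δ + B * τ) * (2 / (1 - l / α)))) := ⟨_, rfl⟩
  set C := (1 + c + (2 * M + 1) * Real.exp (l * (δ + τ + 1))) / (1 - θ) with hC
  set κ := 2 * (A₀ + B₀) + 2 with hκ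
  have hκ0 : 0 ≤ κ := by positivity
  set L := t₁ + δ + τ + 1 with hL
  refine ⟨(|C| + 1) * (3 * Real.exp (κ * L)) * Real.exp (l * t₁), by positivity, l, hl, ?_⟩
  intro s hs φ ψ _ _ hφ hψ x₀ x₁ x v hx
  obtain ⟨D₀, hD₀⟩ : ∃ D₀, D₀ = |x₀| + |x₁| + ⨆ r : Iio s, (|φ r| + |ψ r|) := ⟨_, rfl⟩
  rw [← hD₀]
  have hpast := hx.abs_le_initial_data hφ hψ
  rw [← hD₀] at hpast
  have hD₀0 : 0 ≤ D₀ := (abs_nonneg _).trans (hpast s le_rfl).1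
  obtain ⟨D, hD⟩ : ∃ D, D = 3 * D₀ * Real.exp (κ * L) := ⟨_, rfl⟩
  have hD0 : 0 ≤ D := by rw [hD]; positivity
  set T := max s t₁ with hT
  have hTs : T ≤ s + t₁ := max_le (by linarith) (by linarith)
  have hnear : ∀ r ≤ T + δ + τ + 1, |x r| ≤ D ∧ |v r| ≤ D := by
    intro r hr
    rcases le_total r s with h1 | h1
    · have h2 : D₀ ≤ D := by
        have : 1 ≤ Real.exp (κ * L) := Real.one_le_exp (by positivity)
        rw [hD]
        exact (le_mul_of_one_le_left hD₀0 (by norm_num)).trans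
          (le_mul_of_one_le_right (by positivity) this)
      exact ⟨(hpast r h1).1.trans h2, (hpast r h1).2.trans h2⟩
    · have h2 := hx.abs_le_exp_growth hs hA₀0 hB₀0 haA₀ hbB₀ hgt hht
        (fun t ht => (hpast t ht).1) (fun t ht => (hpast t ht).2) h1
      have h3 : 3 * D₀ * Real.exp (κ * (r - s)) ≤ D := by
        rw [hD]
        gcongr
        linarith
      exact ⟨h2.1.trans h3, h2.2.trans h3⟩
  have hZeq := (ae_restrict_iff' measurableSet_Ici).1 (hZ.equation t₀ ht₀)
  intro t ht
  have hgoal : |x t| ≤ (|C| + 1) * D * (Real.exp (l * t₁) * Real.exp (-l * (t - s))) := by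
    rcases le_total t T with h1 | h1
    · have h2 : 1 ≤ Real.exp (l * t₁) * Real.exp (-l * (t - s)) := by
        rw [← Real.exp_add]
        have := mul_nonneg hl.le (sub_nonneg.2 (h1.trans hTs))
        exact Real.one_le_exp (by linarith)
      have h3 := (hnear t (by linarith)).1
      have h4 : D ≤ (|C| + 1) * D := le_mul_of_one_le_left hD0 (by linarith [abs_nonneg C])
      exact h3.trans (h4.trans (le_mul_of_one_le_right (by positivity) h2))
    · have hlater : ∀ {p : ℝ → Prop}, (∀ᵐ t, t₁ ≤ t → p t) → ∀ᵐ t, T ≤ t → p t := by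
        intro p hp
        filter_upwards [hp] with r hr hTr using hr ((le_max_right _ _).trans hTr)
      have h2 := hx.abs_le_exp_decay (z := fun t => Z t t₀) (le_max_left s t₁) ht₀
        (ht₁.trans (le_max_right s t₁)) h1 hδ0 hτ0 hA0 hB0 hα hβ0 haA₀ haα (hlater haA)
        (hlater hbB) (hlater hba) hgt hht hδ hτ
        (fun S hS => hZ.absolutelyContinuous t₀ ht₀ S hS) (fun r hr => hZpos t₀ r le_rfl hr)
        (hZ.prehistory t₀ ht₀) hZeq hY hM0 hM hl.le hlα hlμ
        (fun r hr => (hnear r hr).1) (fun r hr => (hnear r hr).2) hy hθ hc hθ1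
      refine h2.trans ?_
      rw [← hC, ← Real.exp_add]
      have h3 : C ≤ |C| + 1 := (le_abs_self C).trans (by linarith)
      have h4 : -l * (t - T) ≤ l * t₁ + -l * (t - s) := by
        have := mul_nonneg hl.le (sub_nonneg.2 hTs)
        linarith
      gcongr
  refine hgoal.trans_eq ?_
  rw [hD]
  ring
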